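/- Let $S$ and $B$ be finite-dimensional quantum systems with Hamiltonians $H_S$, $H_B$, let $H_{SB}=H_S\otimes 1+1\otimes H_B$, and let $\tau_B=e^{-\beta H_B}/\mathrm{Tr}\,e^{-\beta H_B}$ with $\beta\in\mathbb R$. Let $W$ be the weight: its Hilbert space is $L^2(\mathbb R)$, its Hamiltonian $H_W$ is multiplication by the energy, $(H_W\psi)(\varepsilon)=\varepsilon\psi(\varepsilon)$, on its maximal domain, and its shifts are $(\Gamma_\delta\psi)(\varepsilon)=\psi(\varepsilon-\delta)$, $\delta\in\mathbb R$. Call a unitary $U$ on $S\otimes B\otimes W$ *admissible* if it is energy-conserving, $[U,H_S+H_B+H_W]=0$ ($U$ preserves the domain of the total Hamiltonian and commutes with it there), and translationally invariant, $[U,\Gamma_\delta]=0$ for all $\delta\in\mathbb R$. With orthonormal eigenbases $H_S|\epsilon_i\rangle=\epsilon_i|\epsilon_i\rangle$ and $H_B|\eta_j\rangle=\eta_j|\eta_j\rangle$ put $$\hat S_S=\sum_i|\epsilon_i\rangle\langle\epsilon_i|\otimes\Gamma_{\epsilon_i},\qquad \hat S=\sum_{i,j}|\epsilon_i\rangle\langle\epsilon_i|\otimes|\eta_j\rangle\langle\eta_j|\otimes\Gamma_{\epsilon_i+\eta_j}.$$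 For a state $\sigma$ of $SB$ let $R(\sigma)=\mathrm{Tr}[H_{SB}\,\sigma]-\min_{V}\mathrm{Tr}[V^\dagger H_{SB}V\sigma]$ be its ergotropy, the minimum being over all unitaries $V$ on $S\otimes B$. For a state $\rho_{SW}$ of $SW$ let $\sigma_S=\mathrm{Tr}_W[\hat S_S\,\rho_{SW}\,\hat S_S^\dagger]$ be the control-marginal state, and let $W(U)=\mathrm{Tr}\big[H_W\big(U(\rho_{SW}\otimes\tau_B)U^\dagger-\rho_{SW}\otimes\tau_B\big)\big]$ be the work, i.e. the change of the average energy of the weight. **Theorem.** 1. A bounded operator $U$ on $S\otimes B\otimes W$ is an admissible unitary if and only if $U=\hat S^\dagger(V_{SB}\otimes 1_W)\hat S$ for some unitary $V_{SB}$ on $S\otimes B$. 2. Let $\rho_{SW}$ be any density operator of $SW$. Then $\rho_{SW}\otimes\tau_B$ is a density operator, $\sigma_S$ is a density matrix and $\mathrm{Tr}_W[\hat S(\rho_{SW}\otimes\tau_B)\hat S^\dagger]=\sigma_S\otimes\tau_B$. There is a unitary $V_{SB}$ with $R(V_{SB}\,\sigma_S\otimes\tau_B\,V_{SB}^\dagger)=0$.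 If moreover the weight has a finite average energy in the state $\rho_{SW}$ (i.e. $|\varepsilon|$ is integrable with respect to its energy distribution), then it has a finite average energy initially and after every $U=\hat S^\dagger(V_{SB}\otimes1_W)\hat S$ with $V_{SB}$ unitary, the work is $$W(U)=R(\sigma_S\otimes\tau_B)-R(V_{SB}\,\sigma_S\otimes\tau_B\,V_{SB}^\dagger),$$ and the optimal work is $$W_{\max}=\max_{U\ \mathrm{admissible}}W(U)=R(\sigma_S\otimes\tau_B).$$ 3. If $\rho_{SW}=\rho_S\otimes\rho_W$ is a product of density operators, then it is a density operator of $SW$ whose marginal on the weight is $\rho_W$, and $$\sigma_S=\int_{\mathbb R}p(t)\,e^{-iH_St}\rho_S\,e^{iH_St}\,dt,$$ where $p(t)=\langle t|\rho_W|t\rangle$ is the probability density of $\rho_W$ with respect to the time states $|t\rangle=(2\pi)^{-1/2}\int e^{i\varepsilon t}|\varepsilon\rangle\,d\varepsilon$; it is integrable with $\int_{\mathbb R} p(t)\,dt=1$. -/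

import Mathlib

open MeasureTheory
open scoped ENNReal Matrix Kronecker ComplexOrder FourierTransform

noncomputable section

namespace Ergo

section HilbertSpace

variable {K : Type*} [NormedAddCommGroup K] [InnerProductSpace ℂ K] [CompleteSpace K]

variable (K) in
/-- The index set of a fixed Hilbert basis of `K`. -/
def basisSet : Set K := (exists_hilbertBasis ℂ K).choose

variable (K) in
/-- A fixed Hilbert basis of `K`. -/
def basis : HilbertBasis (basisSet K) ℂ K := (exists_hilbertBasis ℂ K).choose_spec.choose

/-- The trace of an operator on a Hilbert space
(for trace-class operators it does not depend on the basis). -/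
def opTrace (T : K →L[ℂ] K) : ℂ := ∑' i, inner ℂ (basis K i) (T (basis K i))

/-- The square root of a positive operator. -/
def opSqrt (T : K →L[ℂ] K) : K →L[ℂ] K := CFC.sqrt T

/-- Density operators: positive operators of trace one. -/
structure IsDensityOperator (ρ : K →L[ℂ] K) : Prop where
  isPositive : ρ.IsPositive
  trace_one : HasSum (fun i => inner ℂ (basis K i) (ρ (basis K i))) (1 : ℂ)

end HilbertSpace

/-! ### The weight -/

/-- The Hilbert space `L²(ℝ)` of the weight, in the energy representation `ψ(ε) = ⟨ε|ψ⟩`. -/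
abbrev Weight : Type := Lp ℂ 2 (volume : Measure ℝ)

/-- The Hamiltonian `H_W = ∫ dε ε |ε⟩⟨ε|` of the weight: multiplication by the energy, on its
natural (maximal) domain. -/
def weightHamiltonian : Weight →ₗ.[ℂ] Weight where
  domain :=
    { carrier := {ψ | MemLp (fun ε : ℝ => (ε : ℂ) * ψ ε) 2 volume}
      add_mem' := by
        intro a b ha hb
        refine (memLp_congr_ae ?_).mpr (MemLp.add ha hb)
        filter_upwards [Lp.coeFn_add a b] with ε h
        rw [h]
        simp only [Pi.add_apply, mul_add]
      zero_mem' := by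
        refine (memLp_congr_ae ?_).mpr (MemLp.zero (ε := ℂ))
        filter_upwards [Lp.coeFn_zero ℂ 2 (volume : Measure ℝ)] with ε h
        simp
      smul_mem' := by
        intro c a ha
        refine (memLp_congr_ae ?_).mpr (MemLp.const_smul ha c)
        filter_upwards [Lp.coeFn_smul c a] with ε h
        simp [h, mul_left_comm] }
  toFun :=
    { toFun := fun ψ => MemLp.toLp _ ψ.2
      map_add' := by
        intro a b
        rw [← MemLp.toLp_add]
        apply MemLp.toLp_congr
        filter_upwards [Lp.coeFn_add a.1 b.1] with ε h
        change (ε : ℂ) * (a.1 + b.1 : Weight) ε = _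
        rw [h]
        simp only [Pi.add_apply, mul_add]
      map_smul' := by
        intro c a
        rw [RingHom.id_apply, ← MemLp.toLp_const_smul]
        apply MemLp.toLp_congr
        filter_upwards [Lp.coeFn_smul c a.1] with ε h
        simp [h, mul_left_comm] }

/-- The shift operator `Γ_δ |ε⟩ = |ε + δ⟩` of the weight, i.e. `(Γ_δ ψ)(ε) = ψ(ε - δ)`. -/
def shift (δ : ℝ) : Weight →L[ℂ] Weight :=
  (Lp.compMeasurePreservingₗᵢ ℂ (fun ε : ℝ => ε - δ)
    (measurePreserving_sub_right volume δ)).toContinuousLinearMap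

/-- The energy distribution `⟨ε|ρ|ε⟩ = ‖√ρ |ε⟩‖² = ∑ᵢ |⟨ε|√ρ|bᵢ⟩|²` of a state `ρ` of the
weight. -/
def energyDensity (ρ : Weight →L[ℂ] Weight) (ε : ℝ) : ℝ≥0∞ :=
  ∑' i, ‖(opSqrt ρ (basis Weight i)) ε‖ₑ ^ 2

/-- The distribution `⟨t|ρ|t⟩ = ∑ᵢ |⟨t|√ρ|bᵢ⟩|²` of a state `ρ` of the weight over the time states
`|t⟩ = (2π)^(-1/2) ∫ dε e^(iεt) |ε⟩`. Here `⟨t|ψ⟩ = (2π)^(-1/2) ∫ e^(-iεt) ψ(ε) dε`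
is `(2π)^(-1/2)` times the value at `t / 2π` of Mathlib's Fourier transform of `ψ`. -/
def timeDensity (ρ : Weight →L[ℂ] Weight) (t : ℝ) : ℝ≥0∞ :=
  ENNReal.ofReal (2 * Real.pi)⁻¹ *
    ∑' i, ‖(𝓕 (opSqrt ρ (basis Weight i)) : Weight) (t / (2 * Real.pi))‖ₑ ^ 2

/-- The state `ρ` of the weight has a well-defined, finite average energy. -/
def HasFiniteEnergy (ρ : Weight →L[ℂ] Weight) : Prop :=
  ∫⁻ ε, ‖ε‖ₑ * energyDensity ρ ε < ∞

/-- The average energy `Tr[H_W ρ]` of a state `ρ` of the weight. -/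
def weightEnergy (ρ : Weight →L[ℂ] Weight) : ℝ :=
  ∫ ε, ε * (energyDensity ρ ε).toReal

/-! ### Finite-dimensional systems -/

section Matrices

variable {ι : Type*} [Fintype ι] [DecidableEq ι]

/-- Density matrices. -/
structure IsDensityMatrix (ρ : Matrix ι ι ℂ) : Prop where
  posSemidef : ρ.PosSemidef
  trace_one : ρ.trace = 1

/-- The average energy `E(ρ) = Tr[H ρ]`. -/
def avgEnergy (H ρ : Matrix ι ι ℂ) : ℝ := (H * ρ).trace.re

/-- The passive energy `P(ρ) = min_V Tr[V† H V ρ]`, over all unitaries `V`. -/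
def passiveEnergy (H ρ : Matrix ι ι ℂ) : ℝ :=
  ⨅ V : Matrix.unitaryGroup ι ℂ, ((V : Matrix ι ι ℂ)ᴴ * H * (V : Matrix ι ι ℂ) * ρ).trace.re

/-- The ergotropy `R(ρ) = E(ρ) - P(ρ)`. -/
def ergotropy (H ρ : Matrix ι ι ℂ) : ℝ := avgEnergy H ρ - passiveEnergy H ρ

/-- The Gibbs state `e^(-βH) / Tr e^(-βH)`. -/
def gibbs (β : ℝ) (H : Matrix ι ι ℂ) : Matrix ι ι ℂ :=
  (NormedSpace.exp (-(β : ℂ) • H)).trace⁻¹ • NormedSpace.exp (-(β : ℂ) • H)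

/-- The free evolution `e^(-iHt)`. -/
def evolution (H : Matrix ι ι ℂ) (t : ℝ) : Matrix ι ι ℂ :=
  NormedSpace.exp (-(Complex.I * t) • H)

/-- The projector `|k⟩⟨k|` on the `k`-th vector of an orthonormal eigenbasis of `H`. -/
def eigenProj {H : Matrix ι ι ℂ} (hH : H.IsHermitian) (k : ι) : Matrix ι ι ℂ :=
  Matrix.vecMulVec (hH.eigenvectorBasis k).ofLp (star (hH.eigenvectorBasis k).ofLp)

end Matrices

/-! ### A finite-dimensional system together with the weight -/

/-- The Hilbert space `ℂ^ι ⊗ L²(ℝ)`, realised as the orthogonal sum of `ι` copies of `L²(ℝ)`: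
`∑ₐ |a⟩ ⊗ ψₐ` is the family `(ψₐ)`. -/
abbrev WithWeight (ι : Type*) [Fintype ι] : Type _ := PiLp 2 (fun _ : ι => Weight)

section Composite

variable {ι : Type*} [Fintype ι] [DecidableEq ι]

/-- The operator `∑ₐᵦ |a⟩⟨b| ⊗ B a b`. -/
def ofBlocks (B : Matrix ι ι (Weight →L[ℂ] Weight)) : WithWeight ι →L[ℂ] WithWeight ι :=
  (PiLp.continuousLinearEquiv 2 ℂ (fun _ : ι => Weight)).symm.toContinuousLinearMap ∘L
    ContinuousLinearMap.pi fun a =>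
      ∑ b, B a b ∘L PiLp.proj 2 (𝕜 := ℂ) (fun _ : ι => Weight) b

/-- The block `⟨a| T |b⟩`, an operator on the weight. -/
def block (T : WithWeight ι →L[ℂ] WithWeight ι) (a b : ι) : Weight →L[ℂ] Weight :=
  PiLp.proj 2 (𝕜 := ℂ) (fun _ : ι => Weight) a ∘L T ∘L
    (PiLp.continuousLinearEquiv 2 ℂ (fun _ : ι => Weight)).symm.toContinuousLinearMap ∘L
      ContinuousLinearMap.single ℂ (fun _ : ι => Weight) b

/-- The product operator `A ⊗ T`. -/
def tensor (A : Matrix ι ι ℂ) (T : Weight →L[ℂ] Weight) : WithWeight ι →L[ℂ] WithWeight ι :=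
  ofBlocks fun a b => A a b • T

/-- The partial trace over the weight. -/
def traceOutWeight (T : WithWeight ι →L[ℂ] WithWeight ι) : Matrix ι ι ℂ :=
  Matrix.of fun a b => opTrace (block T a b)

/-- The partial trace over everything but the weight, i.e. the reduced operator of the weight. -/
def weightMarginal (T : WithWeight ι →L[ℂ] WithWeight ι) : Weight →L[ℂ] Weight :=
  ∑ a, block T a a

/-- The Hamiltonian `h ⊗ 1 + 1 ⊗ H_W` on its natural domain. -/
def totalHamiltonian (h : Matrix ι ι ℂ) : WithWeight ι →ₗ.[ℂ] WithWeight ι where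
  domain :=
    { carrier := {Ψ | ∀ a, Ψ a ∈ weightHamiltonian.domain}
      add_mem' := fun hx hy a => weightHamiltonian.domain.add_mem (hx a) (hy a)
      zero_mem' := fun _ => weightHamiltonian.domain.zero_mem
      smul_mem' := fun c _ hx a => weightHamiltonian.domain.smul_mem c (hx a) }
  toFun :=
    { toFun := fun Ψ => WithLp.toLp 2 fun a =>
        (∑ b, h a b • Ψ.1 b) + weightHamiltonian ⟨Ψ.1 a, Ψ.2 a⟩
      map_add' := by
        intro x y
        ext1 a
        have : weightHamiltonian ⟨(x + y).1 a, (x + y).2 a⟩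
            = weightHamiltonian ⟨x.1 a, x.2 a⟩ + weightHamiltonian ⟨y.1 a, y.2 a⟩ :=
          weightHamiltonian.map_add ⟨x.1 a, x.2 a⟩ ⟨y.1 a, y.2 a⟩
        simp only [this]
        simp [Finset.sum_add_distrib, smul_add]
        abel
      map_smul' := by
        intro c x
        ext1 a
        have : weightHamiltonian ⟨(c • x).1 a, (c • x).2 a⟩
            = c • weightHamiltonian ⟨x.1 a, x.2 a⟩ :=
          weightHamiltonian.map_smul c ⟨x.1 a, x.2 a⟩
        simp only [this]
        simp [Finset.smul_sum, smul_add, smul_comm c] }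

/-- `U` is an energy-conserving and translationally invariant unitary:
`[U, h ⊗ 1 + 1 ⊗ H_W] = 0` and `[U, 1 ⊗ Γ_δ] = 0` for all real `δ`. The first relation involves an
unbounded operator: `U` maps its domain into itself and commutes with it there. -/
structure IsAdmissible (h : Matrix ι ι ℂ) (U : WithWeight ι →L[ℂ] WithWeight ι) : Prop where
  unitary : U ∈ unitary (WithWeight ι →L[ℂ] WithWeight ι)
  energy_conserving : ∀ Ψ : (totalHamiltonian h).domain,
    ∃ hU : U Ψ ∈ (totalHamiltonian h).domain,
      totalHamiltonian h ⟨U Ψ, hU⟩ = U (totalHamiltonian h Ψ)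
  translation_invariant : ∀ δ : ℝ, U * tensor 1 (shift δ) = tensor 1 (shift δ) * U

/-- The state of the weight after `ρ → U ρ U†`. -/
def finalWeight (U ρ : WithWeight ι →L[ℂ] WithWeight ι) : Weight →L[ℂ] Weight :=
  weightMarginal (U * ρ * star U)

/-- The work `W = Tr[H_W (U ρ U† - ρ)]`: the change of the average energy of the weight. -/
def work (U ρ : WithWeight ι →L[ℂ] WithWeight ι) : ℝ :=
  weightEnergy (finalWeight U ρ) - weightEnergy (weightMarginal ρ)

/-- The control-shift operator `∑ₖ |k⟩⟨k| ⊗ Γ_(εₖ)` of a system. -/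
def controlShift {H : Matrix ι ι ℂ} (hH : H.IsHermitian) : WithWeight ι →L[ℂ] WithWeight ι :=
  ∑ k, tensor (eigenProj hH k) (shift (hH.eigenvalues k))

/-- The control-marginal state `σ_S = Tr_W[S_S ρ_SW S_S†]` of the system. -/
def controlMarginal {H : Matrix ι ι ℂ} (hH : H.IsHermitian)
    (ρ : WithWeight ι →L[ℂ] WithWeight ι) : Matrix ι ι ℂ :=
  traceOutWeight (controlShift hH * ρ * star (controlShift hH))

end Composite

section SystemBath

variable {n m : Type*} [Fintype n] [DecidableEq n] [Fintype m] [DecidableEq m]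

/-- The Hamiltonian `H_S ⊗ 1 + 1 ⊗ H_B` of system and bath. -/
def hamiltonianSB (H_S : Matrix n n ℂ) (H_B : Matrix m m ℂ) : Matrix (n × m) (n × m) ℂ :=
  H_S ⊗ₖ (1 : Matrix m m ℂ) + (1 : Matrix n n ℂ) ⊗ₖ H_B

/-- The state `ρ_SW ⊗ τ_B` of system, bath and weight. -/
def attachBath (ρ : WithWeight n →L[ℂ] WithWeight n) (τ : Matrix m m ℂ) :
    WithWeight (n × m) →L[ℂ] WithWeight (n × m) :=
  ofBlocks fun x y => τ x.2 y.2 • block ρ x.1 y.1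

/-- The control-shift operator `S = ∑ᵢⱼ |εᵢ⟩⟨εᵢ| ⊗ |ηⱼ⟩⟨ηⱼ| ⊗ Γ_(εᵢ + ηⱼ)`. -/
def controlShiftSB {H_S : Matrix n n ℂ} {H_B : Matrix m m ℂ}
    (hS : H_S.IsHermitian) (hB : H_B.IsHermitian) :
    WithWeight (n × m) →L[ℂ] WithWeight (n × m) :=
  ∑ i, ∑ j, tensor (eigenProj hS i ⊗ₖ eigenProj hB j)
    (shift (hS.eigenvalues i + hB.eigenvalues j))

/-- The operator `S† (V ⊗ 1) S`. -/
def dressed {H_S : Matrix n n ℂ} {H_B : Matrix m m ℂ}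
    (hS : H_S.IsHermitian) (hB : H_B.IsHermitian) (V : Matrix (n × m) (n × m) ℂ) :
    WithWeight (n × m) →L[ℂ] WithWeight (n × m) :=
  star (controlShiftSB hS hB) * tensor V 1 * controlShiftSB hS hB

end SystemBath

end Ergo

end

set_option linter.unusedSectionVars false

noncomputable section

/-! Part 1. Since H_W Γ_δ = Γ_δ (H_W + δ), the control shift turns the total Hamiltonian into that
of the weight: H_W Ŝ = Ŝ (H_SB + H_W). It also commutes with the shifts. Hence U is admissible
exactly when the unitary Ŝ U Ŝ† commutes with H_W and with all Γ_δ, that is, when each of its blocks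
⟨a|·|b⟩ does. Only scalars on L²(ℝ) do so (`CommutesWithEnergy.exists_eq_smul_one`): commuting with
multiplication by the energy forces locality, and translation invariance makes the local factor
constant. Hence Ŝ U Ŝ† = V ⊗ 1 (`isAdmissible_iff`).

Part 2. Put T' = Ŝ T Ŝ†. The factor V ⊗ 1 does not change the reduced state of the weight, and Ŝ†
then moves the part of that state belonging to the energy E_k by -E_k. So the final weight energy is
that of T' minus the average of H_SB in V σ V†, where σ = Tr_W T' (`weightEnergy_conj_star_ctrl`).
The choice V = 1 gives the initial energy, so the work is the drop of the average of H_SB from σ to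
V σ V†; the passive energy is unitarily invariant, so this is the drop of ergotropy
(`work_dressed`). Compactness of the unitary group supplies a V leaving no ergotropy, and
nonnegativity of ergotropy gives optimality. For T = ρ_SW ⊗ τ_B the bath part of Ŝ only shifts the
weight, separately in each eigenspace of τ_B, which the partial trace cannot see; so σ = σ_S ⊗ τ_B
(`traceOutWeight_conj_controlShiftSB`).

Part 3. Fourier transformation turns shifts into phases, so Tr[Γ_a ρ_W Γ_b†] is the integral of p(t)
e^{-it(a-b)} (`hasSum_inner_shift_conj`). These are the coefficients that multiply P_k ρ_S P_l, both
in σ_S and in the averaged free evolution.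

Traces in infinite dimension are handled through √T: positive traces are Hilbert-Schmidt norms with
values in `ℝ≥0∞`, and blocks of T are products A†B of Hilbert-Schmidt operators, whose traces
converge absolutely. -/

namespace Ergo

/-! ### Traces and Hilbert-Schmidt operators -/

section HilbertSchmidt

variable {K K' : Type*} [NormedAddCommGroup K] [InnerProductSpace ℂ K] [CompleteSpace K]
  [NormedAddCommGroup K'] [InnerProductSpace ℂ K'] [CompleteSpace K']
variable {κ κ' : Type*}

/-- A family satisfying Parseval's identity, for instance a Hilbert basis. -/
def IsParseval (v : κ → K) : Prop := ∀ x : K, ∑' i, ‖inner ℂ (v i) x‖ₑ ^ 2 = ‖x‖ₑ ^ 2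

lemma enorm_sq_eq_ofReal {E : Type*} [SeminormedAddCommGroup E] (x : E) :
    ‖x‖ₑ ^ 2 = ENNReal.ofReal (‖x‖ ^ 2) := by
  rw [← ofReal_norm, ENNReal.ofReal_pow (norm_nonneg _)]

lemma isParseval_hilbertBasis (b : HilbertBasis κ ℂ K) : IsParseval b := by
  intro x
  have h := b.hasSum_inner_mul_inner x x
  have h2 : HasSum (fun i => ‖inner ℂ (b i) x‖ ^ 2) (‖x‖ ^ 2) := by
    have := h.mapL Complex.reCLM
    rw [Complex.reCLM_apply, inner_self_eq_norm_sq_to_K] at this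
    convert this using 1
    · ext i
      rw [← inner_conj_symm x, Complex.reCLM_apply, Complex.conj_mul']
      norm_cast
    · norm_cast
  rw [enorm_sq_eq_ofReal, ← h2.tsum_eq, ENNReal.ofReal_tsum_of_nonneg (fun _ => sq_nonneg _)
    h2.summable]
  simp only [enorm_sq_eq_ofReal]

lemma isParseval_basis : IsParseval (basis K) := isParseval_hilbertBasis _

/-- The Hilbert-Schmidt norm of an operator is that of its adjoint. -/
lemma tsum_enorm_sq_adjoint {v : κ → K} {w : κ' → K'} (hv : IsParseval v) (hw : IsParseval w)
    (A : K →L[ℂ] K') :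
    ∑' i, ‖A (v i)‖ₑ ^ 2 = ∑' j, ‖ContinuousLinearMap.adjoint A (w j)‖ₑ ^ 2 := by
  calc ∑' i, ‖A (v i)‖ₑ ^ 2 = ∑' i, ∑' j, ‖inner ℂ (w j) (A (v i))‖ₑ ^ 2 := by
        simp only [hw _]
    _ = ∑' j, ∑' i, ‖inner ℂ (w j) (A (v i))‖ₑ ^ 2 := ENNReal.tsum_comm
    _ = ∑' j, ∑' i, ‖inner ℂ (v i) (ContinuousLinearMap.adjoint A (w j))‖ₑ ^ 2 := by
        refine tsum_congr fun j => tsum_congr fun i => ?_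
        rw [ContinuousLinearMap.adjoint_inner_right, ← ofReal_norm, ← ofReal_norm,
          norm_inner_symm]
    _ = _ := by simp only [hv _]

lemma opSqrt_isPositive (T : K →L[ℂ] K) : (opSqrt T).IsPositive :=
  (ContinuousLinearMap.nonneg_iff_isPositive _).mp (CFC.sqrt_nonneg T)

lemma star_opSqrt (T : K →L[ℂ] K) : star (opSqrt T) = opSqrt T :=
  (opSqrt_isPositive T).isSelfAdjoint

lemma adjoint_opSqrt (T : K →L[ℂ] K) : ContinuousLinearMap.adjoint (opSqrt T) = opSqrt T :=
  star_opSqrt T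

lemma opSqrt_mul_self {T : K →L[ℂ] K} (hT : T.IsPositive) : opSqrt T * opSqrt T = T :=
  CFC.sqrt_mul_sqrt_self T ((ContinuousLinearMap.nonneg_iff_isPositive _).mpr hT)

lemma inner_opSqrt_apply {T : K →L[ℂ] K} (hT : T.IsPositive) (x y : K) :
    inner ℂ (opSqrt T x) (opSqrt T y) = inner ℂ x (T y) := by
  conv_rhs => rw [← opSqrt_mul_self hT]
  rw [← ContinuousLinearMap.adjoint_inner_right, adjoint_opSqrt]
  rfl

lemma enorm_opSqrt_apply_sq {T : K →L[ℂ] K} (hT : T.IsPositive) (x : K) :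
    ‖opSqrt T x‖ₑ ^ 2 = ENNReal.ofReal (inner ℂ x (T x)).re := by
  rw [← inner_opSqrt_apply hT, enorm_sq_eq_ofReal, inner_self_eq_norm_sq_to_K]
  norm_cast

/-- The trace of a positive operator. -/
def posTrace (T : K →L[ℂ] K) : ℝ≥0∞ :=
  ∑' i, ENNReal.ofReal (inner ℂ (basis K i) (T (basis K i))).re

/-- Both sides are Hilbert-Schmidt norms of √T, and passing to the adjoint removes the family in
which the norm was computed. Parseval's identity suffices, so families such as U†b_i are allowed. -/
lemma posTrace_eq_tsum {T : K →L[ℂ] K} (hT : T.IsPositive) {v : κ → K} (hv : IsParseval v) :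
    posTrace T = ∑' i, ENNReal.ofReal (inner ℂ (v i) (T (v i))).re := by
  simp only [posTrace, ← enorm_opSqrt_apply_sq hT]
  rw [tsum_enorm_sq_adjoint isParseval_basis isParseval_basis,
    tsum_enorm_sq_adjoint hv isParseval_basis]

lemma posTrace_eq_tsum_opSqrt {T : K →L[ℂ] K} (hT : T.IsPositive) {v : κ → K}
    (hv : IsParseval v) : posTrace T = ∑' i, ‖opSqrt T (v i)‖ₑ ^ 2 := by
  simp only [posTrace_eq_tsum hT hv, enorm_opSqrt_apply_sq hT]

lemma re_inner_apply_nonneg {T : K →L[ℂ] K} (hT : T.IsPositive) (x : K) :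
    0 ≤ (inner ℂ x (T x)).re := hT.re_inner_nonneg_right x

lemma posTrace_add {S T : K →L[ℂ] K} (hS : S.IsPositive) (hT : T.IsPositive) :
    posTrace (S + T) = posTrace S + posTrace T := by
  simp only [posTrace]
  rw [← ENNReal.tsum_add]
  congr! 2 with i
  rw [← ENNReal.ofReal_add]
  · simp
  · exact re_inner_apply_nonneg hS _
  · exact re_inner_apply_nonneg hT _

lemma posTrace_sum {s : Finset κ} {T : κ → K →L[ℂ] K} (hT : ∀ k, (T k).IsPositive) :
    posTrace (∑ k ∈ s, T k) = ∑ k ∈ s, posTrace (T k) := by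
  classical
  induction s using Finset.induction_on with
  | empty => simp [posTrace]
  | insert a s ha ih =>
    rw [Finset.sum_insert ha, Finset.sum_insert ha, posTrace_add (hT a), ih]
    exact ContinuousLinearMap.isPositive_sum _ fun k _ => hT k

/-- For positive T the diagonal entries are nonnegative reals, so the complex sum and the
`ℝ≥0∞`-valued one carry the same information; the latter needs no summability. -/
lemma isDensityOperator_iff {T : K →L[ℂ] K} :
    IsDensityOperator T ↔ T.IsPositive ∧ posTrace T = 1 := by
  constructor
  · rintro ⟨hT, h⟩
    refine ⟨hT, ?_⟩
    have h2 : HasSum (fun i => (inner ℂ (basis K i) (T (basis K i))).re) 1 := by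
      simpa using h.mapL Complex.reCLM
    rw [posTrace, ← ENNReal.ofReal_tsum_of_nonneg (fun i => re_inner_apply_nonneg hT _) h2.summable,
      h2.tsum_eq]
    simp
  · rintro ⟨hT, h⟩
    refine ⟨hT, ?_⟩
    have hs : Summable fun i => (inner ℂ (basis K i) (T (basis K i))).re := by
      have := ENNReal.summable_toReal (h.trans_ne ENNReal.one_ne_top)
      refine this.congr fun i => ?_
      rw [ENNReal.toReal_ofReal (re_inner_apply_nonneg hT _)]
    have h1 : ∑' i, (inner ℂ (basis K i) (T (basis K i))).re = 1 := by
      rw [posTrace, ← ENNReal.ofReal_tsum_of_nonneg (fun i => re_inner_apply_nonneg hT _) hs] at h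
      simpa using h
    have h2 : HasSum (fun i => (((inner ℂ (basis K i) (T (basis K i))).re : ℝ) : ℂ)) ((1 : ℝ) : ℂ) :=
      Complex.hasSum_ofReal.mpr (h1 ▸ hs.hasSum)
    rw [Complex.ofReal_one] at h2
    refine h2.congr_fun fun i => ?_
    have h3 := hT.inner_nonneg_right (basis K i)
    exact Complex.ext rfl (by simpa using (Complex.le_def.mp h3).2.symm)

lemma summable_norm_sq {E : Type*} [NormedAddCommGroup E] {f : κ → E}
    (h : ∑' i, ‖f i‖ₑ ^ 2 ≠ ∞) : Summable fun i => ‖f i‖ ^ 2 := by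
  refine (ENNReal.summable_toReal h).congr fun i => ?_
  simp [ENNReal.toReal_pow]

/-- Each term is at most |⟨w_j, A v_i⟩|² + |⟨w_j, B v_i⟩|², and by Parseval these double series sum
to the squared Hilbert-Schmidt norms. Absolute convergence permits changing the order of summation.
-/
lemma summable_inner_mul_inner (v : HilbertBasis κ ℂ K) (w : HilbertBasis κ' ℂ K')
    (A B : K →L[ℂ] K')
    (hA : ∑' i, ‖A (v i)‖ₑ ^ 2 ≠ ∞) (hB : ∑' i, ‖B (v i)‖ₑ ^ 2 ≠ ∞) :
    Summable fun p : κ × κ' => inner ℂ (A (v p.1)) (w p.2) * inner ℂ (w p.2) (B (v p.1)) := by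
  have aux : ∀ C : K →L[ℂ] K', ∑' i, ‖C (v i)‖ₑ ^ 2 ≠ ∞ →
      Summable fun p : κ × κ' => ‖inner ℂ (w p.2) (C (v p.1))‖ ^ 2 := by
    intro C hC
    apply summable_norm_sq
    rw [ENNReal.tsum_prod (f := fun i j => ‖inner ℂ (w j) (C (v i))‖ₑ ^ 2)]
    have hw := isParseval_hilbertBasis w
    simpa only [hw _] using hC
  refine Summable.of_norm_bounded ((aux A hA).add (aux B hB)) fun p => ?_
  rw [norm_mul, norm_inner_symm]
  nlinarith [two_mul_le_add_sq ‖inner ℂ (w p.2) (A (v p.1))‖ ‖inner ℂ (w p.2) (B (v p.1))‖,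
    mul_nonneg (norm_nonneg (inner ℂ (w p.2) (A (v p.1))))
      (norm_nonneg (inner ℂ (w p.2) (B (v p.1))))]

/-- The trace of `A† B`, for Hilbert-Schmidt operators `A` and `B`, is the trace of `B A†`. -/
lemma hasSum_inner_adjoint_comp (v : HilbertBasis κ ℂ K) (w : HilbertBasis κ' ℂ K')
    (A B : K →L[ℂ] K')
    (hA : ∑' i, ‖A (v i)‖ₑ ^ 2 ≠ ∞) (hB : ∑' i, ‖B (v i)‖ₑ ^ 2 ≠ ∞) :
    HasSum (fun i => inner ℂ (A (v i)) (B (v i)))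
      (∑' j, inner ℂ (ContinuousLinearMap.adjoint B (w j))
        (ContinuousLinearMap.adjoint A (w j))) := by
  -- The same double family is summed along its rows, giving ⟨A v_i, B v_i⟩, and along its columns,
  -- giving ⟨B†w_j, A†w_j⟩.
  have hF := (summable_inner_mul_inner v w A B hA hB).hasSum
  have hF' := (Equiv.prodComm κ' κ).hasSum_iff.mpr hF
  have h1 := hF.prod_fiberwise fun i => w.hasSum_inner_mul_inner (A (v i)) (B (v i))
  have h2 := hF'.prod_fiberwise fun j => by
    refine (v.hasSum_inner_mul_inner (ContinuousLinearMap.adjoint B (w j))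
      (ContinuousLinearMap.adjoint A (w j))).congr_fun fun i => ?_
    simp only [Function.comp_apply, Equiv.prodComm_apply, Prod.fst_swap, Prod.snd_swap,
      ContinuousLinearMap.adjoint_inner_left, ContinuousLinearMap.adjoint_inner_right]
    exact mul_comm _ _
  rwa [h2.tsum_eq]

lemma opTrace_adjoint_comp (A B : K →L[ℂ] K')
    (hA : ∑' i, ‖A (basis K i)‖ₑ ^ 2 ≠ ∞) (hB : ∑' i, ‖B (basis K i)‖ₑ ^ 2 ≠ ∞) :
    opTrace (ContinuousLinearMap.adjoint A ∘L B) =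
      ∑' j, inner ℂ (ContinuousLinearMap.adjoint B (basis K' j))
        (ContinuousLinearMap.adjoint A (basis K' j)) := by
  rw [← (hasSum_inner_adjoint_comp (basis K) (basis K') A B hA hB).tsum_eq]
  simp [opTrace, ContinuousLinearMap.adjoint_inner_right]

end HilbertSchmidt

/-! ### Block operators and partial traces -/

section Blocks

variable {ι : Type*} [Fintype ι] [DecidableEq ι]

/-- The isometry `ψ ↦ |a⟩ ⊗ ψ`. -/
def inj (a : ι) : Weight →L[ℂ] WithWeight ι :=
  (PiLp.continuousLinearEquiv 2 ℂ (fun _ : ι => Weight)).symm.toContinuousLinearMap ∘L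
      ContinuousLinearMap.single ℂ (fun _ : ι => Weight) a

lemma inj_apply (a : ι) (ψ : Weight) (c : ι) : inj a ψ c = if c = a then ψ else 0 := by
  simp [inj]

lemma block_apply (T : WithWeight ι →L[ℂ] WithWeight ι) (a b : ι) (ψ : Weight) :
    block T a b ψ = T (inj b ψ) a := rfl

lemma sum_inj_apply (Ψ : WithWeight ι) : ∑ a, inj a (Ψ a) = Ψ := by
  ext1 c
  simp [WithLp.ofLp_sum, Finset.sum_apply, inj_apply]

lemma inner_inj_left (a : ι) (ψ : Weight) (Ψ : WithWeight ι) :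
    inner ℂ (inj a ψ) Ψ = inner ℂ ψ (Ψ a) := by
  rw [PiLp.inner_apply, Finset.sum_eq_single a]
  · simp [inj_apply]
  · intro b _ hb
    simp [inj_apply, hb]
  · simp

lemma adjoint_inj_apply (a : ι) (Ψ : WithWeight ι) :
    ContinuousLinearMap.adjoint (inj a) Ψ = Ψ a := by
  refine ext_inner_left ℂ fun ψ => ?_
  rw [ContinuousLinearMap.adjoint_inner_right, inner_inj_left]

lemma inner_block (T : WithWeight ι →L[ℂ] WithWeight ι) (a b : ι) (φ ψ : Weight) :
    inner ℂ φ (block T a b ψ) = inner ℂ (inj a φ) (T (inj b ψ)) := by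
  rw [block_apply, inner_inj_left]

lemma apply_eq_sum_block (T : WithWeight ι →L[ℂ] WithWeight ι) (Ψ : WithWeight ι) (a : ι) :
    T Ψ a = ∑ b, block T a b (Ψ b) := by
  conv_lhs => rw [← sum_inj_apply Ψ, map_sum]
  simp [WithLp.ofLp_sum, Finset.sum_apply, block_apply]

lemma ext_block {S T : WithWeight ι →L[ℂ] WithWeight ι} (h : ∀ a b, block S a b = block T a b) :
    S = T := by
  ext1 Ψ
  ext1 a
  simp only [apply_eq_sum_block, h]

@[simp] lemma block_ofBlocks (B : Matrix ι ι (Weight →L[ℂ] Weight)) (a b : ι) :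
    block (ofBlocks B) a b = B a b := by
  ext1 ψ
  rw [block_apply]
  simp only [ofBlocks, ContinuousLinearMap.comp_apply]
  change (∑ c, B a c ∘L PiLp.proj 2 (𝕜 := ℂ) (fun _ : ι => Weight) c) (inj b ψ) = _
  rw [sum_apply, Finset.sum_eq_single b]
  · simp [inj_apply]
  · intro c _ hc
    simp [inj_apply, hc]
  · simp

lemma block_mul (S T : WithWeight ι →L[ℂ] WithWeight ι) (a b : ι) :
    block (S * T) a b = ∑ c, block S a c * block T c b := by
  ext1 ψ
  rw [block_apply, mul_apply_eq_comp, apply_eq_sum_block]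
  simp [block_apply]

lemma block_star (T : WithWeight ι →L[ℂ] WithWeight ι) (a b : ι) :
    block (star T) a b = star (block T b a) := by
  ext1 ψ
  refine ext_inner_left ℂ fun φ => ?_
  rw [inner_block, ContinuousLinearMap.star_eq_adjoint, ContinuousLinearMap.star_eq_adjoint,
    ContinuousLinearMap.adjoint_inner_right, ContinuousLinearMap.adjoint_inner_right,
    ← inner_conj_symm, ← inner_block, inner_conj_symm]

@[simp] lemma block_add (S T : WithWeight ι →L[ℂ] WithWeight ι) (a b : ι) :
    block (S + T) a b = block S a b + block T a b := rfl

lemma block_sum {κ : Type*} (s : Finset κ) (T : κ → WithWeight ι →L[ℂ] WithWeight ι) (a b : ι) :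
    block (∑ k ∈ s, T k) a b = ∑ k ∈ s, block (T k) a b := by
  classical
  induction s using Finset.induction_on with
  | empty => ext1 ψ; simp [block_apply]
  | insert k s hk ih => rw [Finset.sum_insert hk, Finset.sum_insert hk, block_add, ih]

lemma block_one (a b : ι) :
    block (1 : WithWeight ι →L[ℂ] WithWeight ι) a b = (1 : Matrix ι ι ℂ) a b • 1 := by
  ext1 ψ
  rw [block_apply]
  simp only [one_apply_eq_self, inj_apply, Matrix.one_apply]
  split_ifs <;> simp

lemma block_tensor (A : Matrix ι ι ℂ) (T : Weight →L[ℂ] Weight) (a b : ι) :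
    block (tensor A T) a b = A a b • T :=
  block_ofBlocks _ a b

lemma tensor_mul (A B : Matrix ι ι ℂ) (S T : Weight →L[ℂ] Weight) :
    tensor A S * tensor B T = tensor (A * B) (S * T) := by
  refine ext_block fun a b => ?_
  rw [block_mul, block_tensor, Matrix.mul_apply, Finset.sum_smul]
  simp only [block_tensor, smul_mul_smul_comm]

lemma star_tensor (A : Matrix ι ι ℂ) (T : Weight →L[ℂ] Weight) :
    star (tensor A T) = tensor Aᴴ (star T) := by
  refine ext_block fun a b => ?_
  rw [block_star, block_tensor, block_tensor, star_smul, Matrix.conjTranspose_apply]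

lemma tensor_one_one : tensor (1 : Matrix ι ι ℂ) 1 = 1 := by
  refine ext_block fun a b => ?_
  rw [block_tensor, block_one]

lemma tensor_sum_left {κ : Type*} (s : Finset κ) (A : κ → Matrix ι ι ℂ)
    (T : Weight →L[ℂ] Weight) : tensor (∑ k ∈ s, A k) T = ∑ k ∈ s, tensor (A k) T := by
  refine ext_block fun a b => ?_
  rw [block_sum, block_tensor, Matrix.sum_apply, Finset.sum_smul]
  simp only [block_tensor]

lemma tensor_zero_left (T : Weight →L[ℂ] Weight) : tensor (0 : Matrix ι ι ℂ) T = 0 := by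
  simpa using tensor_sum_left (∅ : Finset Empty) (fun _ => (0 : Matrix ι ι ℂ)) T

lemma isParseval_inj {κ : Type*} {v : κ → Weight} (hv : IsParseval v) :
    IsParseval fun p : ι × κ => inj p.1 (v p.2) := by
  intro Ψ
  rw [ENNReal.tsum_prod (f := fun a i => ‖inner ℂ (inj a (v i)) Ψ‖ₑ ^ 2)]
  simp only [inner_inj_left, hv _]
  rw [tsum_fintype, enorm_sq_eq_ofReal, PiLp.norm_sq_eq_of_L2,
    ENNReal.ofReal_sum_of_nonneg fun _ _ => sq_nonneg _]
  simp only [enorm_sq_eq_ofReal]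

lemma block_eq_conj (T : WithWeight ι →L[ℂ] WithWeight ι) (a b : ι) :
    block T a b = ContinuousLinearMap.adjoint (inj a) ∘L T ∘L inj b := by
  ext1 ψ
  simp [block_apply, adjoint_inj_apply]

lemma isPositive_block {T : WithWeight ι →L[ℂ] WithWeight ι} (hT : T.IsPositive) (a : ι) :
    (block T a a).IsPositive := by
  rw [block_eq_conj]
  exact hT.adjoint_conj (inj a)

lemma isPositive_weightMarginal {T : WithWeight ι →L[ℂ] WithWeight ι} (hT : T.IsPositive) :
    (weightMarginal T).IsPositive :=
  ContinuousLinearMap.isPositive_sum _ fun a _ => isPositive_block hT a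

lemma posTrace_eq_sum_block {T : WithWeight ι →L[ℂ] WithWeight ι} (hT : T.IsPositive) :
    posTrace T = ∑ a, posTrace (block T a a) := by
  rw [posTrace_eq_tsum hT (isParseval_inj isParseval_basis),
    ENNReal.tsum_prod (f := fun a i => ENNReal.ofReal
      (inner ℂ (inj a (basis Weight i)) (T (inj a (basis Weight i)))).re), tsum_fintype]
  simp only [posTrace, inner_block]

lemma posTrace_weightMarginal {T : WithWeight ι →L[ℂ] WithWeight ι} (hT : T.IsPositive) :
    posTrace (weightMarginal T) = posTrace T := by
  rw [posTrace_eq_sum_block hT, weightMarginal, posTrace_sum fun a => isPositive_block hT a]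

lemma tsum_opSqrt_inj {T : WithWeight ι →L[ℂ] WithWeight ι} (hT : T.IsPositive) (a : ι) :
    ∑' i, ‖(opSqrt T ∘L inj a) (basis Weight i)‖ₑ ^ 2 = posTrace (block T a a) := by
  simp only [ContinuousLinearMap.comp_apply, enorm_opSqrt_apply_sq hT, posTrace, inner_block]

lemma tsum_opSqrt_inj_ne_top {T : WithWeight ι →L[ℂ] WithWeight ι} (hT : T.IsPositive)
    (h : posTrace T ≠ ∞) (a : ι) :
    ∑' i, ‖(opSqrt T ∘L inj a) (basis Weight i)‖ₑ ^ 2 ≠ ∞ := by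
  rw [tsum_opSqrt_inj hT]
  rw [posTrace_eq_sum_block hT] at h
  exact ne_top_of_le_ne_top h (Finset.single_le_sum (f := fun a => posTrace (block T a a))
    (fun _ _ => zero_le) (Finset.mem_univ a))

/-- An off-diagonal block is not positive; written as A†B with A, B Hilbert-Schmidt, it still has an
absolutely convergent trace. -/
lemma block_eq_opSqrt {T : WithWeight ι →L[ℂ] WithWeight ι} (hT : T.IsPositive) (a b : ι) :
    block T a b =
      ContinuousLinearMap.adjoint (opSqrt T ∘L inj a) ∘L (opSqrt T ∘L inj b) := by
  rw [block_eq_conj, ContinuousLinearMap.adjoint_comp, adjoint_opSqrt]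
  conv_lhs => rw [← opSqrt_mul_self hT]
  rfl

lemma hasSum_block {T : WithWeight ι →L[ℂ] WithWeight ι} (hT : T.IsPositive)
    (h : posTrace T ≠ ∞) (a b : ι) :
    HasSum (fun i => inner ℂ (basis Weight i) (block T a b (basis Weight i)))
      (traceOutWeight T a b) := by
  have := hasSum_inner_adjoint_comp (basis Weight) (basis (WithWeight ι)) _ _
    (tsum_opSqrt_inj_ne_top hT h a) (tsum_opSqrt_inj_ne_top hT h b)
  rw [traceOutWeight, Matrix.of_apply, opTrace, block_eq_opSqrt hT]
  simp only [ContinuousLinearMap.comp_apply _ (opSqrt T ∘L inj b),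
    ContinuousLinearMap.adjoint_inner_right]
  exact this.summable.hasSum

lemma traceOutWeight_conj_tensor {T : WithWeight ι →L[ℂ] WithWeight ι} (hT : T.IsPositive)
    (h : posTrace T ≠ ∞) (A : Matrix ι ι ℂ) :
    traceOutWeight (tensor A 1 * T * star (tensor A 1)) = A * traceOutWeight T * Aᴴ := by
  ext a b
  rw [traceOutWeight, Matrix.of_apply, opTrace, star_tensor, star_one, Matrix.mul_apply]
  refine HasSum.tsum_eq ?_
  simp only [Matrix.mul_apply, Finset.sum_mul, block_mul, block_tensor,
    sum_apply, inner_sum]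
  refine hasSum_sum fun c _ => hasSum_sum fun d _ => ?_
  refine (((hasSum_block hT h d c).mul_left (A a d)).mul_right (Aᴴ c b)).congr_fun fun i => ?_
  simp [inner_smul_right]
  ring

lemma trace_traceOutWeight {T : WithWeight ι →L[ℂ] WithWeight ι} (hT : T.IsPositive)
    (h : posTrace T ≠ ∞) : (traceOutWeight T).trace = ((posTrace T).toReal : ℂ) := by
  have h1 : ∀ a, traceOutWeight T a a = ((posTrace (block T a a)).toReal : ℂ) := by
    intro a
    have h2 := hasSum_block hT h a a
    have hp := isPositive_block hT a
    have h3 : ∀ i, inner ℂ (basis Weight i) (block T a a (basis Weight i)) =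
        ((inner ℂ (basis Weight i) (block T a a (basis Weight i))).re : ℂ) := fun i =>
      Complex.ext rfl (by
        simpa using (Complex.le_def.mp (hp.inner_nonneg_right (basis Weight i))).2.symm)
    rw [← h2.tsum_eq, tsum_congr h3, ← Complex.ofReal_tsum, posTrace]
    rw [← ENNReal.ofReal_tsum_of_nonneg (fun i => re_inner_apply_nonneg hp _)
      (by simpa using (h2.mapL Complex.reCLM).summable), ENNReal.toReal_ofReal]
    exact tsum_nonneg fun i => re_inner_apply_nonneg hp _
  rw [Matrix.trace, posTrace_eq_sum_block hT, ENNReal.toReal_sum, Complex.ofReal_sum]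
  · simp [h1]
  · intro a _
    rw [posTrace_eq_sum_block hT] at h
    exact ne_top_of_le_ne_top h (Finset.single_le_sum (f := fun a => posTrace (block T a a))
      (fun _ _ => zero_le) (Finset.mem_univ a))

/-- The quadratic form of Tr_W T at x is the sum over i of the expectations of T in the vectors ∑ₐ
xₐ |a⟩ ⊗ b_i. -/
lemma posSemidef_traceOutWeight {T : WithWeight ι →L[ℂ] WithWeight ι} (hT : T.IsPositive)
    (h : posTrace T ≠ ∞) : (traceOutWeight T).PosSemidef := by
  have key : ∀ x : ι → ℂ, HasSum (fun i => inner ℂ (∑ a, x a • inj a (basis Weight i))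
      (T (∑ a, x a • inj a (basis Weight i)))) (star x ⬝ᵥ (traceOutWeight T *ᵥ x)) := by
    intro x
    simp only [map_sum, map_smul, inner_sum, sum_inner, inner_smul_left, inner_smul_right,
      dotProduct, Matrix.mulVec, Finset.mul_sum, ← inner_block]
    rw [Finset.sum_comm]
    refine hasSum_sum fun b _ => hasSum_sum fun a _ => ?_
    refine (((hasSum_block hT h a b).mul_right (x b)).mul_left (star x a)).congr_fun fun i => ?_
    simp
    ring
  refine Matrix.PosSemidef.of_dotProduct_mulVec_nonneg ?_ fun x => ?_
  · ext a b
    rw [Matrix.conjTranspose_apply, ← (hasSum_block hT h a b).tsum_eq,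
      ← (hasSum_block hT h b a).star.tsum_eq]
    refine tsum_congr fun i => ?_
    rw [inner_block, inner_block]
    change (starRingEnd ℂ) _ = _
    rw [inner_conj_symm, hT.inner_left_eq_inner_right]
  · rw [← (key x).tsum_eq]
    exact tsum_nonneg fun i => hT.inner_nonneg_right _

/-- Cyclicity of the partial trace over the finite system: the blocks of A ⊗ 1 are scalars and the
sums are finite, so no trace-class condition is needed. -/
lemma weightMarginal_mul_tensor_comm (A : Matrix ι ι ℂ) (T : WithWeight ι →L[ℂ] WithWeight ι) :
    weightMarginal (T * tensor A 1) = weightMarginal (tensor A 1 * T) := by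
  simp only [weightMarginal, block_mul, block_tensor]
  rw [Finset.sum_comm]
  simp

lemma isPositive_star_mul_self (B : WithWeight ι →L[ℂ] WithWeight ι) :
    (star B * B).IsPositive :=
  ContinuousLinearMap.isPositive_adjoint_comp_self B

lemma isPositive_mul_mul_star {K : Type*} [NormedAddCommGroup K] [InnerProductSpace ℂ K]
    [CompleteSpace K] {T : K →L[ℂ] K} (hT : T.IsPositive) (A : K →L[ℂ] K) :
    (A * T * star A).IsPositive := by
  have := hT.conj_adjoint A
  rwa [← ContinuousLinearMap.comp_assoc] at this

/-- The trace of A T A† is the squared Hilbert-Schmidt norm of √T A†, hence of its adjoint A √T, and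
the isometry A preserves the norms of the vectors √T b_i. -/
lemma posTrace_conj_of_isometry {K : Type*} [NormedAddCommGroup K] [InnerProductSpace ℂ K]
    [CompleteSpace K] {T : K →L[ℂ] K} (hT : T.IsPositive) {A : K →L[ℂ] K}
    (hA : star A * A = 1) : posTrace (A * T * star A) = posTrace T := by
  rw [posTrace_eq_tsum_opSqrt hT isParseval_basis]
  have h1 : ∀ i, ENNReal.ofReal (inner ℂ (basis K i) ((A * T * star A) (basis K i))).re =
      ‖(opSqrt T ∘L star A) (basis K i)‖ₑ ^ 2 := by
    intro i
    rw [ContinuousLinearMap.comp_apply, enorm_opSqrt_apply_sq hT, ContinuousLinearMap.star_eq_adjoint,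
      ContinuousLinearMap.adjoint_inner_left]
    rfl
  rw [posTrace, tsum_congr h1, tsum_enorm_sq_adjoint isParseval_basis isParseval_basis]
  refine tsum_congr fun i => ?_
  rw [ContinuousLinearMap.adjoint_comp, ContinuousLinearMap.star_eq_adjoint,
    ContinuousLinearMap.adjoint_adjoint, adjoint_opSqrt, ContinuousLinearMap.comp_apply]
  have h2 : ‖A (opSqrt T (basis K i))‖ = ‖opSqrt T (basis K i)‖ :=
    (ContinuousLinearMap.norm_map_iff_adjoint_comp_self A).mpr hA _
  rw [enorm_sq_eq_ofReal, h2, enorm_sq_eq_ofReal]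

end Blocks

/-! ### Spectral resolutions and the Gibbs state -/

section Resolution

variable {ι κ κ' : Type*} [Fintype ι] [DecidableEq ι] [Fintype κ] [DecidableEq κ]

/-- A family of pairwise orthogonal orthogonal projections with sum one. -/
structure IsResolution (P : κ → Matrix ι ι ℂ) : Prop where
  isHermitian : ∀ k, (P k)ᴴ = P k
  mul_eq : ∀ k l, P k * P l = if k = l then P k else 0
  sum_eq : ∑ k, P k = 1

/-- The dictionary between functional calculus by projectors and diagonal matrices; the resolution
of the identity, the spectral theorem and the exponential are all read off from it. -/
lemma sum_smul_eigenProj {H : Matrix ι ι ℂ} (hH : H.IsHermitian) (f : ι → ℂ) :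
    ∑ k, f k • eigenProj hH k = (hH.eigenvectorUnitary : Matrix ι ι ℂ) * Matrix.diagonal f *
      (hH.eigenvectorUnitary : Matrix ι ι ℂ)ᴴ := by
  ext a b
  rw [Matrix.sum_apply, Matrix.mul_apply]
  refine Finset.sum_congr rfl fun k _ => ?_
  simp [eigenProj, Matrix.vecMulVec_apply, Matrix.mul_diagonal]
  ring

lemma unitary_mul_conjTranspose {V : Matrix ι ι ℂ} (hV : V ∈ Matrix.unitaryGroup ι ℂ) :
    V * Vᴴ = 1 := (Matrix.mem_unitaryGroup_iff).mp hV

lemma unitary_conjTranspose_mul {V : Matrix ι ι ℂ} (hV : V ∈ Matrix.unitaryGroup ι ℂ) :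
    Vᴴ * V = 1 := (Matrix.mem_unitaryGroup_iff').mp hV

lemma eigenProj_eq {H : Matrix ι ι ℂ} (hH : H.IsHermitian) (k : ι) :
    eigenProj hH k = (hH.eigenvectorUnitary : Matrix ι ι ℂ) *
      Matrix.diagonal (Pi.single k 1) * (hH.eigenvectorUnitary : Matrix ι ι ℂ)ᴴ := by
  rw [← sum_smul_eigenProj, Finset.sum_eq_single k]
  · simp
  · intro l _ hl
    simp [hl]
  · simp

lemma isResolution_eigenProj {H : Matrix ι ι ℂ} (hH : H.IsHermitian) :
    IsResolution (eigenProj hH) where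
  isHermitian k := by
    ext a b
    simp [eigenProj, Matrix.vecMulVec_apply, Matrix.conjTranspose_apply, mul_comm]
  mul_eq k l := by
    rw [eigenProj_eq, eigenProj_eq]
    have h := unitary_conjTranspose_mul hH.eigenvectorUnitary.2
    set U : Matrix ι ι ℂ := hH.eigenvectorUnitary.1
    rw [show U * Matrix.diagonal (Pi.single k 1) * Uᴴ * (U * Matrix.diagonal (Pi.single l 1) * Uᴴ)
      = U * Matrix.diagonal (Pi.single k 1) * (Uᴴ * U) * Matrix.diagonal (Pi.single l 1) * Uᴴ by
        simp only [mul_assoc], h, mul_one, mul_assoc U, Matrix.diagonal_mul_diagonal]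
    split_ifs with hkl
    · subst hkl
      congr! 4 with i
      by_cases hi : i = k
      · subst hi; simp
      · simp [hi]
    · have : (fun i => (Pi.single k (1 : ℂ) : ι → ℂ) i * (Pi.single l (1 : ℂ) : ι → ℂ) i) = 0 := by
        ext i
        by_cases hi : i = k
        · subst hi; simp [hkl]
        · simp [hi]
      rw [this]
      simp
  sum_eq := by
    have := sum_smul_eigenProj hH 1
    simp only [Pi.one_apply, one_smul] at this
    rw [this, Pi.one_def, Matrix.diagonal_one, mul_one,
      unitary_mul_conjTranspose hH.eigenvectorUnitary.2]

lemma sum_eigenvalues_smul_eigenProj {H : Matrix ι ι ℂ} (hH : H.IsHermitian) :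
    ∑ k, (hH.eigenvalues k : ℂ) • eigenProj hH k = H := by
  rw [sum_smul_eigenProj]
  exact hH.spectral_theorem.symm

lemma exp_smul_eq_sum {H : Matrix ι ι ℂ} (hH : H.IsHermitian) (c : ℂ) :
    NormedSpace.exp (c • H) = ∑ k, Complex.exp (c * hH.eigenvalues k) • eigenProj hH k := by
  rw [sum_smul_eigenProj]
  have hU := unitary_mul_conjTranspose hH.eigenvectorUnitary.2
  have hinv : (hH.eigenvectorUnitary.1 : Matrix ι ι ℂ)⁻¹ = (hH.eigenvectorUnitary.1)ᴴ :=
    Matrix.inv_eq_right_inv hU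
  have hunit : IsUnit (hH.eigenvectorUnitary.1 : Matrix ι ι ℂ) :=
    IsUnit.of_mul_eq_one _ hU
  conv_lhs => rw [← sum_eigenvalues_smul_eigenProj hH, Finset.smul_sum]
  simp only [smul_smul]
  rw [sum_smul_eigenProj, ← hinv, Matrix.exp_conj _ _ hunit, Matrix.exp_diagonal]
  congr 3
  ext k
  rw [Pi.coe_exp, Complex.exp_eq_exp_ℂ]

lemma trace_eigenProj {H : Matrix ι ι ℂ} (hH : H.IsHermitian) (k : ι) :
    (eigenProj hH k).trace = 1 := by
  have h := unitary_conjTranspose_mul hH.eigenvectorUnitary.2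
  rw [eigenProj_eq, Matrix.trace_mul_comm, ← mul_assoc, h, one_mul, Matrix.trace_diagonal]
  simp

lemma posSemidef_eigenProj {H : Matrix ι ι ℂ} (hH : H.IsHermitian) (k : ι) :
    (eigenProj hH k).PosSemidef :=
  Matrix.posSemidef_vecMulVec_self_star _

/-- The eigenvalues of the Gibbs state. -/
def gibbsWeight {H : Matrix ι ι ℂ} (hH : H.IsHermitian) (β : ℝ) (k : ι) : ℝ :=
  (∑ l, Real.exp (-β * hH.eigenvalues l))⁻¹ * Real.exp (-β * hH.eigenvalues k)

lemma gibbs_eq_sum {H : Matrix ι ι ℂ} (hH : H.IsHermitian) (β : ℝ) :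
    gibbs β H = ∑ k, (gibbsWeight hH β k : ℂ) • eigenProj hH k := by
  rw [gibbs, exp_smul_eq_sum hH, Matrix.trace_sum, Finset.smul_sum]
  refine Finset.sum_congr rfl fun k _ => ?_
  simp [Matrix.trace_smul, trace_eigenProj, gibbsWeight, smul_smul]

lemma isDensityMatrix_gibbs [Nonempty ι] {H : Matrix ι ι ℂ} (hH : H.IsHermitian) (β : ℝ) :
    IsDensityMatrix (gibbs β H) := by
  have hZ : 0 < ∑ l, Real.exp (-β * hH.eigenvalues l) :=
    Finset.sum_pos (fun _ _ => Real.exp_pos _) Finset.univ_nonempty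
  constructor
  · rw [gibbs_eq_sum hH]
    refine Matrix.posSemidef_sum _ fun k _ => (posSemidef_eigenProj hH k).smul ?_
    rw [Complex.zero_le_real]
    exact mul_nonneg (inv_nonneg.mpr hZ.le) (Real.exp_pos _).le
  · rw [gibbs_eq_sum hH, Matrix.trace_sum]
    simp only [Matrix.trace_smul, trace_eigenProj, smul_eq_mul, mul_one, gibbsWeight]
    rw [← Complex.ofReal_sum, ← Finset.mul_sum, inv_mul_cancel₀ hZ.ne', Complex.ofReal_one]

variable [Fintype κ'] [DecidableEq κ'] {ι' : Type*} [Fintype ι'] [DecidableEq ι']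

lemma IsResolution.kronecker {P : κ → Matrix ι ι ℂ} {Q : κ' → Matrix ι' ι' ℂ}
    (hP : IsResolution P) (hQ : IsResolution Q) :
    IsResolution fun p : κ × κ' => P p.1 ⊗ₖ Q p.2 where
  isHermitian p := by rw [Matrix.conjTranspose_kronecker, hP.isHermitian, hQ.isHermitian]
  mul_eq p q := by
    rw [← Matrix.mul_kronecker_mul, hP.mul_eq, hQ.mul_eq]
    rcases p with ⟨i, j⟩
    rcases q with ⟨k, l⟩
    by_cases h1 : i = k <;> by_cases h2 : j = l <;> simp [h1, h2]
  sum_eq := by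
    rw [Fintype.sum_prod_type]
    have : ∀ i, ∑ j, P i ⊗ₖ Q j = P i ⊗ₖ (1 : Matrix ι' ι' ℂ) := fun i => by
      rw [← hQ.sum_eq]
      ext a b
      simp [Matrix.sum_apply, Matrix.kroneckerMap_apply, Finset.mul_sum]
    simp only [this]
    rw [← Matrix.one_kronecker_one, ← hP.sum_eq]
    ext a b
    simp [Matrix.sum_apply, Matrix.kroneckerMap_apply, Finset.sum_mul]

lemma sum_smul_kronecker {P : κ → Matrix ι ι ℂ} {Q : κ' → Matrix ι' ι' ℂ}
    (hP : IsResolution P) (hQ : IsResolution Q) (E : κ → ℝ) (F : κ' → ℝ) :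
    ∑ p : κ × κ', ((E p.1 + F p.2 : ℝ) : ℂ) • (P p.1 ⊗ₖ Q p.2) =
      hamiltonianSB (∑ k, (E k : ℂ) • P k) (∑ l, (F l : ℂ) • Q l) := by
  have h1 : (1 : Matrix ι ι ℂ) = ∑ k, P k := hP.sum_eq.symm
  have h2 : (1 : Matrix ι' ι' ℂ) = ∑ k, Q k := hQ.sum_eq.symm
  rw [hamiltonianSB, h1, h2, Fintype.sum_prod_type]
  ext a b
  simp only [Matrix.sum_apply, Matrix.add_apply, Matrix.kroneckerMap_apply, Matrix.smul_apply,
    Finset.sum_mul_sum, smul_eq_mul, ← Finset.sum_add_distrib]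
  refine Finset.sum_congr rfl fun i _ => Finset.sum_congr rfl fun j _ => ?_
  push_cast
  ring

end Resolution

/-! ### The shifts and the control-shift operators -/

section Shift

lemma shift_coeFn (δ : ℝ) (ψ : Weight) : shift δ ψ =ᵐ[volume] fun ε => ψ (ε - δ) :=
  Lp.coeFn_compMeasurePreserving ψ (measurePreserving_sub_right volume δ)

lemma norm_shift (δ : ℝ) (ψ : Weight) : ‖shift δ ψ‖ = ‖ψ‖ :=
  (Lp.compMeasurePreservingₗᵢ ℂ (fun ε : ℝ => ε - δ)
    (measurePreserving_sub_right volume δ)).norm_map ψ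

lemma shift_mul (δ δ' : ℝ) : shift δ * shift δ' = shift (δ + δ') := by
  ext1 ψ
  apply Lp.ext
  have h := (measurePreserving_sub_right volume δ).quasiMeasurePreserving.ae (shift_coeFn δ' ψ)
  filter_upwards [shift_coeFn δ (shift δ' ψ), shift_coeFn (δ + δ') ψ, h] with ε h1 h2 h3
  rw [mul_apply_eq_comp]
  rw [h1, h2, h3]
  congr 1
  ring

lemma shift_zero : shift 0 = 1 := by
  ext1 ψ
  apply Lp.ext
  filter_upwards [shift_coeFn 0 ψ] with ε h1
  rw [h1]
  simp

lemma star_shift (δ : ℝ) : star (shift δ) = shift (-δ) := by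
  have h : star (shift δ) * shift δ = 1 :=
    (ContinuousLinearMap.norm_map_iff_adjoint_comp_self _).mp (norm_shift δ)
  have h2 : shift δ * shift (-δ) = 1 := by rw [shift_mul, add_neg_cancel, shift_zero]
  calc star (shift δ) = star (shift δ) * (shift δ * shift (-δ)) := by rw [h2, mul_one]
    _ = shift (-δ) := by rw [← mul_assoc, h, one_mul]

lemma star_shift_mul (δ δ' : ℝ) : star (shift δ) * shift δ' = shift (δ' - δ) := by
  rw [star_shift, shift_mul]
  congr 1
  ring

variable {ι κ : Type*} [Fintype ι] [DecidableEq ι] [Fintype κ] [DecidableEq κ]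

/-- The operator `∑ₖ Pₖ ⊗ Γ_(Eₖ)`. -/
def ctrl (P : κ → Matrix ι ι ℂ) (E : κ → ℝ) : WithWeight ι →L[ℂ] WithWeight ι :=
  ∑ k, tensor (P k) (shift (E k))

lemma controlShiftSB_eq_ctrl {n m : Type*} [Fintype n] [DecidableEq n] [Fintype m] [DecidableEq m]
    {H_S : Matrix n n ℂ} {H_B : Matrix m m ℂ} (hS : H_S.IsHermitian) (hB : H_B.IsHermitian) :
    controlShiftSB hS hB = ctrl (fun p : n × m => eigenProj hS p.1 ⊗ₖ eigenProj hB p.2)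
      fun p => hS.eigenvalues p.1 + hB.eigenvalues p.2 := by
  rw [controlShiftSB, ctrl, Fintype.sum_prod_type]

variable {P : κ → Matrix ι ι ℂ}

lemma star_ctrl (hP : IsResolution P) (E : κ → ℝ) : star (ctrl P E) = ctrl P (-E) := by
  rw [ctrl, ContinuousLinearMap.star_eq_adjoint, map_sum]
  simp only [← ContinuousLinearMap.star_eq_adjoint, star_tensor, hP.isHermitian, star_shift]
  rfl

/-- Orthogonality of the P_k leaves only equal indices, so the energies add. Together with the
formula for the adjoint this makes the control shifts unitary. -/
lemma ctrl_mul (hP : IsResolution P) (E F : κ → ℝ) : ctrl P E * ctrl P F = ctrl P (E + F) := by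
  rw [ctrl, ctrl, ctrl, Finset.sum_mul_sum]
  refine Finset.sum_congr rfl fun k _ => ?_
  rw [Finset.sum_eq_single k]
  · rw [tensor_mul, hP.mul_eq, if_pos rfl, shift_mul]
    rfl
  · intro l _ hl
    rw [tensor_mul, hP.mul_eq, if_neg hl.symm, tensor_zero_left]
  · simp

lemma ctrl_zero (hP : IsResolution P) : ctrl P 0 = 1 := by
  simp only [ctrl, Pi.zero_apply, shift_zero]
  rw [← tensor_sum_left, hP.sum_eq, tensor_one_one]

lemma star_ctrl_mul_self (hP : IsResolution P) (E : κ → ℝ) : star (ctrl P E) * ctrl P E = 1 := by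
  rw [star_ctrl hP, ctrl_mul hP, neg_add_cancel, ctrl_zero hP]

lemma ctrl_mul_star_self (hP : IsResolution P) (E : κ → ℝ) : ctrl P E * star (ctrl P E) = 1 := by
  rw [star_ctrl hP, ctrl_mul hP, add_neg_cancel, ctrl_zero hP]

lemma ctrl_mul_shift (E : κ → ℝ) (δ : ℝ) :
    ctrl P E * tensor 1 (shift δ) = tensor 1 (shift δ) * ctrl P E := by
  simp only [ctrl, Finset.sum_mul, Finset.mul_sum, tensor_mul, mul_one, one_mul, shift_mul,
    add_comm δ]

end Shift

/-! ### Attaching the bath -/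

section Bath

variable {n m : Type*} [Fintype n] [DecidableEq n] [Fintype m] [DecidableEq m]

@[simp] lemma block_attachBath (ρ : WithWeight n →L[ℂ] WithWeight n) (τ : Matrix m m ℂ)
    (x y : n × m) : block (attachBath ρ τ) x y = τ x.2 y.2 • block ρ x.1 y.1 :=
  block_ofBlocks _ x y

lemma attachBath_mul (ρ ρ' : WithWeight n →L[ℂ] WithWeight n) (τ τ' : Matrix m m ℂ) :
    attachBath ρ τ * attachBath ρ' τ' = attachBath (ρ * ρ') (τ * τ') := by
  refine ext_block fun x y => ?_
  simp only [block_mul, block_attachBath, Matrix.mul_apply, Finset.sum_smul_sum,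
    smul_mul_smul_comm]
  rw [Fintype.sum_prod_type, Finset.sum_comm]

lemma star_attachBath (ρ : WithWeight n →L[ℂ] WithWeight n) (τ : Matrix m m ℂ) :
    star (attachBath ρ τ) = attachBath (star ρ) τᴴ := by
  refine ext_block fun x y => ?_
  simp only [block_star, block_attachBath, star_smul, Matrix.conjTranspose_apply]

lemma attachBath_zero_right (ρ : WithWeight n →L[ℂ] WithWeight n) :
    attachBath ρ (0 : Matrix m m ℂ) = 0 := by
  refine ext_block fun x y => ?_
  rw [block_attachBath, Matrix.zero_apply, zero_smul]
  rfl

open scoped MatrixOrder Matrix.Norms.L2Operator in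
lemma exists_eq_conjTranspose_mul_self {τ : Matrix m m ℂ} (hτ : τ.PosSemidef) :
    ∃ C : Matrix m m ℂ, τ = Cᴴ * C :=
  CStarAlgebra.nonneg_iff_eq_star_mul_self.mp hτ.nonneg

/-- With τ = C†C the operator is B†B for B = √ρ ⊗ C. -/
lemma isPositive_attachBath {ρ : WithWeight n →L[ℂ] WithWeight n} (hρ : ρ.IsPositive)
    {τ : Matrix m m ℂ} (hτ : τ.PosSemidef) : (attachBath ρ τ).IsPositive := by
  obtain ⟨C, rfl⟩ := exists_eq_conjTranspose_mul_self hτ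
  rw [← opSqrt_mul_self hρ, ← attachBath_mul]
  conv in (attachBath (opSqrt ρ) Cᴴ) => rw [← star_opSqrt ρ, ← star_attachBath]
  exact isPositive_star_mul_self _

lemma weightMarginal_attachBath (ρ : WithWeight n →L[ℂ] WithWeight n) {τ : Matrix m m ℂ}
    (hτ : τ.trace = 1) : weightMarginal (attachBath ρ τ) = weightMarginal ρ := by
  rw [weightMarginal, Fintype.sum_prod_type]
  simp only [block_attachBath]
  refine Finset.sum_congr rfl fun a _ => ?_
  rw [← Finset.sum_smul]
  rw [Matrix.trace] at hτ
  simp only [Matrix.diag_apply] at hτ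
  rw [hτ, one_smul]

lemma isDensityOperator_attachBath {ρ : WithWeight n →L[ℂ] WithWeight n}
    (hρ : IsDensityOperator ρ) {τ : Matrix m m ℂ} (hτ : IsDensityMatrix τ) :
    IsDensityOperator (attachBath ρ τ) := by
  rw [isDensityOperator_iff] at hρ ⊢
  have hpos := isPositive_attachBath hρ.1 hτ.posSemidef
  refine ⟨hpos, ?_⟩
  rw [← posTrace_weightMarginal hpos, weightMarginal_attachBath ρ hτ.trace_one,
    posTrace_weightMarginal hρ.1, hρ.2]

lemma isPositive_tensor {A : Matrix n n ℂ} (hA : A.PosSemidef) {T : Weight →L[ℂ] Weight}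
    (hT : T.IsPositive) : (tensor A T).IsPositive := by
  obtain ⟨C, rfl⟩ := exists_eq_conjTranspose_mul_self hA
  rw [← opSqrt_mul_self hT, ← tensor_mul]
  conv in (tensor Cᴴ (opSqrt T)) => rw [← star_opSqrt T, ← star_tensor]
  exact isPositive_star_mul_self _

lemma weightMarginal_tensor {A : Matrix n n ℂ} (hA : A.trace = 1) (T : Weight →L[ℂ] Weight) :
    weightMarginal (tensor A T) = T := by
  simp only [weightMarginal, block_tensor]
  rw [← Finset.sum_smul]
  rw [Matrix.trace] at hA
  simp only [Matrix.diag_apply] at hA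
  rw [hA, one_smul]

lemma isDensityOperator_tensor {A : Matrix n n ℂ} (hA : IsDensityMatrix A)
    {T : Weight →L[ℂ] Weight} (hT : IsDensityOperator T) : IsDensityOperator (tensor A T) := by
  rw [isDensityOperator_iff] at hT ⊢
  have hpos := isPositive_tensor hA.posSemidef hT.1
  refine ⟨hpos, ?_⟩
  rw [← posTrace_weightMarginal hpos, weightMarginal_tensor hA.trace_one, hT.2]

lemma IsDensityOperator.conj_ctrl {κ : Type*} [Fintype κ] [DecidableEq κ] {P : κ → Matrix n n ℂ}
    (hP : IsResolution P) (E : κ → ℝ) {ρ : WithWeight n →L[ℂ] WithWeight n}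
    (hρ : IsDensityOperator ρ) : IsDensityOperator (ctrl P E * ρ * star (ctrl P E)) := by
  rw [isDensityOperator_iff] at hρ ⊢
  exact ⟨isPositive_mul_mul_star hρ.1 _,
    (posTrace_conj_of_isometry hρ.1 (star_ctrl_mul_self hP E)).trans hρ.2⟩

lemma isDensityMatrix_traceOutWeight {ρ : WithWeight n →L[ℂ] WithWeight n}
    (hρ : IsDensityOperator ρ) : IsDensityMatrix (traceOutWeight ρ) := by
  rw [isDensityOperator_iff] at hρ
  have h : posTrace ρ ≠ ∞ := by simp [hρ.2]
  refine ⟨posSemidef_traceOutWeight hρ.1 h, ?_⟩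
  rw [trace_traceOutWeight hρ.1 h, hρ.2]
  simp

lemma isDensityMatrix_controlMarginal {H : Matrix n n ℂ} (hH : H.IsHermitian)
    {ρ : WithWeight n →L[ℂ] WithWeight n} (hρ : IsDensityOperator ρ) :
    IsDensityMatrix (controlMarginal hH ρ) :=
  isDensityMatrix_traceOutWeight (hρ.conj_ctrl (isResolution_eigenProj hH) _)

lemma block_one_tensor_conj (U : Weight →L[ℂ] Weight) (T : WithWeight n →L[ℂ] WithWeight n)
    (a b : n) : block (tensor 1 U * T * star (tensor 1 U)) a b = U * block T a b * star U := by
  simp only [star_tensor, block_mul, block_tensor, Matrix.conjTranspose_one]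
  simp [Matrix.one_apply]

/-- The partial trace over the weight does not change under unitaries of the weight. -/
lemma traceOutWeight_conj_one_tensor {T : WithWeight n →L[ℂ] WithWeight n} (hT : T.IsPositive)
    (h : posTrace T ≠ ∞) {U : Weight →L[ℂ] Weight} (hU : star U * U = 1) :
    traceOutWeight (tensor 1 U * T * star (tensor 1 U)) = traceOutWeight T := by
  have hnorm : ∀ x, ‖U x‖ = ‖x‖ := (ContinuousLinearMap.norm_map_iff_adjoint_comp_self U).mpr hU
  have hinner : ∀ x y, inner ℂ (U x) (U y) = inner ℂ x y :=
    (ContinuousLinearMap.inner_map_map_iff_adjoint_comp_self U).mpr hU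
  -- The coefficients of x are those of Ux in the basis, and U is isometric. This carries finiteness
  -- of the Hilbert-Schmidt norms over to the conjugated operators.
  have hv : IsParseval fun i => star U (basis Weight i) := fun x => by
    simp only [ContinuousLinearMap.star_eq_adjoint, ContinuousLinearMap.adjoint_inner_left]
    rw [isParseval_basis (U x), enorm_sq_eq_ofReal, hnorm, enorm_sq_eq_ofReal]
  have hfin : ∀ a, ∑' i, ‖((opSqrt T ∘L inj a) ∘L star U) (basis Weight i)‖ₑ ^ 2 ≠ ∞ := by
    intro a
    have := tsum_opSqrt_inj_ne_top hT h a
    rw [tsum_enorm_sq_adjoint isParseval_basis isParseval_basis] at this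
    rw [← tsum_enorm_sq_adjoint hv isParseval_basis] at this
    exact this
  ext a b
  rw [traceOutWeight, traceOutWeight, Matrix.of_apply, Matrix.of_apply, block_one_tensor_conj]
  have h1 : U * block T a b * star U = ContinuousLinearMap.adjoint ((opSqrt T ∘L inj a) ∘L star U)
      ∘L ((opSqrt T ∘L inj b) ∘L star U) := by
    rw [block_eq_opSqrt hT, ContinuousLinearMap.adjoint_comp _ (star U),
      ContinuousLinearMap.star_eq_adjoint, ContinuousLinearMap.adjoint_adjoint]
    rfl
  -- After exchanging the factors of A†B, U stands in front of both vectors of each inner product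
  -- and drops out.
  rw [h1, opTrace_adjoint_comp _ _ (hfin a) (hfin b), block_eq_opSqrt hT,
    opTrace_adjoint_comp _ _ (tsum_opSqrt_inj_ne_top hT h a) (tsum_opSqrt_inj_ne_top hT h b)]
  have h2 : ∀ a w, ContinuousLinearMap.adjoint ((opSqrt T ∘L inj a) ∘L star U) w =
      U (ContinuousLinearMap.adjoint (opSqrt T ∘L inj a) w) := fun a w => by
    rw [ContinuousLinearMap.adjoint_comp _ (star U), ContinuousLinearMap.star_eq_adjoint,
      ContinuousLinearMap.adjoint_adjoint, ContinuousLinearMap.comp_apply U]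
  simp only [h2, hinner]

lemma star_shift_mul_self (δ : ℝ) : star (shift δ) * shift δ = 1 := by
  rw [star_shift_mul, sub_self, shift_zero]

lemma controlShiftSB_eq_sum_attachBath {H_S : Matrix n n ℂ} {H_B : Matrix m m ℂ}
    (hS : H_S.IsHermitian) (hB : H_B.IsHermitian) :
    controlShiftSB hS hB = ∑ l, attachBath
      (tensor 1 (shift (hB.eigenvalues l)) * controlShift hS) (eigenProj hB l) := by
  refine ext_block fun x y => ?_
  rw [controlShiftSB, Finset.sum_comm]
  simp only [controlShift, Finset.mul_sum, tensor_mul, one_mul, shift_mul, block_sum,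
    block_attachBath, block_tensor, Matrix.kroneckerMap_apply, Finset.smul_sum, smul_smul]
  refine Finset.sum_congr rfl fun l _ => Finset.sum_congr rfl fun k _ => ?_
  rw [mul_comm, add_comm]

/-- A bath operator that is a function of H_B commutes with the eigenprojectors Q_l, so the cross
terms vanish. What remains in the l-th component is conjugation by Ŝ_S followed by a shift of the
weight by η_l. -/
lemma conj_controlShiftSB_attachBath {H_S : Matrix n n ℂ} {H_B : Matrix m m ℂ}
    (hS : H_S.IsHermitian) (hB : H_B.IsHermitian) (ρ : WithWeight n →L[ℂ] WithWeight n)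
    (t : m → ℂ) :
    controlShiftSB hS hB * attachBath ρ (∑ l, t l • eigenProj hB l) * star (controlShiftSB hS hB) =
      ∑ l, attachBath (tensor 1 (shift (hB.eigenvalues l)) *
        (controlShift hS * ρ * star (controlShift hS)) *
          star (tensor 1 (shift (hB.eigenvalues l)))) (t l • eigenProj hB l) := by
  have hQ := isResolution_eigenProj hB
  have key : ∀ k l, eigenProj hB k * (∑ j, t j • eigenProj hB j) * eigenProj hB l =
      if k = l then t k • eigenProj hB k else 0 := by
    intro k l
    rw [Finset.mul_sum, Finset.sum_eq_single k]
    · rw [Matrix.mul_smul, hQ.mul_eq, if_pos rfl, Matrix.smul_mul, hQ.mul_eq]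
      split_ifs <;> simp
    · intro j _ hj
      rw [Matrix.mul_smul, hQ.mul_eq, if_neg hj.symm, smul_zero]
    · simp
  rw [controlShiftSB_eq_sum_attachBath]
  -- The bath operator is made opaque so that distributing sums does not expand it and `key` still
  -- applies.
  generalize ∑ j, t j • eigenProj hB j = τ at key ⊢
  simp only [ContinuousLinearMap.star_eq_adjoint, map_sum]
  simp only [← ContinuousLinearMap.star_eq_adjoint, star_attachBath, hQ.isHermitian,
    Finset.sum_mul, Finset.mul_sum, attachBath_mul, key]
  rw [Finset.sum_comm]
  refine Finset.sum_congr rfl fun k _ => ?_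
  rw [Finset.sum_eq_single k]
  · rw [if_pos rfl, star_mul]
    simp only [mul_assoc]
  · intro l _ hl
    rw [if_neg hl.symm, attachBath_zero_right]
  · simp

/-- In every bath component the extra shift of the weight is invisible after tracing out the weight,
so each component contributes the same σ_S and the components reassemble to τ_B. -/
lemma traceOutWeight_conj_controlShiftSB {H_S : Matrix n n ℂ} {H_B : Matrix m m ℂ}
    (hS : H_S.IsHermitian) (hB : H_B.IsHermitian) {ρ : WithWeight n →L[ℂ] WithWeight n}
    (hρ : IsDensityOperator ρ) (β : ℝ) :
    traceOutWeight (controlShiftSB hS hB * attachBath ρ (gibbs β H_B) *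
      star (controlShiftSB hS hB)) = controlMarginal hS ρ ⊗ₖ gibbs β H_B := by
  rw [gibbs_eq_sum hB, conj_controlShiftSB_attachBath]
  set ω := controlShift hS * ρ * star (controlShift hS) with hω
  have hωd := isDensityOperator_iff.mp (hρ.conj_ctrl (isResolution_eigenProj hS) hS.eigenvalues)
  rw [show ctrl (eigenProj hS) hS.eigenvalues * ρ * star (ctrl (eigenProj hS) hS.eigenvalues) = ω
    from rfl] at hωd
  have hfin : posTrace ω ≠ ∞ := by simp [hωd.2]
  ext x y
  rw [traceOutWeight, Matrix.of_apply, opTrace]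
  refine HasSum.tsum_eq ?_
  simp only [block_sum, block_attachBath, sum_apply, inner_sum, Matrix.kroneckerMap_apply,
    Matrix.sum_apply, Finset.mul_sum]
  refine hasSum_sum fun l _ => ?_
  have hΓ : star (tensor (1 : Matrix n n ℂ) (shift (hB.eigenvalues l))) *
      tensor 1 (shift (hB.eigenvalues l)) = 1 := by
    rw [star_tensor, tensor_mul, star_shift_mul_self, Matrix.conjTranspose_one, one_mul,
      tensor_one_one]
  have h1 := hasSum_block (isPositive_mul_mul_star hωd.1 (tensor 1 (shift (hB.eigenvalues l))))
    (by rwa [posTrace_conj_of_isometry hωd.1 hΓ]) x.1 y.1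
  rw [traceOutWeight_conj_one_tensor hωd.1 hfin (star_shift_mul_self _)] at h1
  rw [controlMarginal]
  refine (h1.mul_right _).congr_fun fun i => ?_
  simp [inner_smul_right]
  ring

end Bath

/-! ### The reduced state of the weight, split by energy levels -/

section Pinching

variable {ι κ : Type*} [Fintype ι] [DecidableEq ι] [Fintype κ] [DecidableEq κ]

/-- The part of the reduced state of the weight that belongs to the projection `P`. -/
def pinchedMarginal (P : Matrix ι ι ℂ) (T : WithWeight ι →L[ℂ] WithWeight ι) :
    Weight →L[ℂ] Weight :=
  weightMarginal (tensor P 1 * T * star (tensor P 1))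

lemma weightMarginal_sum {s : Finset κ} (T : κ → WithWeight ι →L[ℂ] WithWeight ι) :
    weightMarginal (∑ k ∈ s, T k) = ∑ k ∈ s, weightMarginal (T k) := by
  simp only [weightMarginal, block_sum]
  exact Finset.sum_comm

lemma weightMarginal_one_tensor_mul_mul (S R : Weight →L[ℂ] Weight)
    (T : WithWeight ι →L[ℂ] WithWeight ι) :
    weightMarginal (tensor 1 S * T * tensor 1 R) = S * weightMarginal T * R := by
  simp only [weightMarginal, block_mul, block_tensor, Finset.mul_sum, Finset.sum_mul]
  simp [Matrix.one_apply]

variable {P : κ → Matrix ι ι ℂ}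

/-- By cyclicity the two projections meet, and P_l P_k = 0 for k ≠ l: coherences between levels do
not reach the reduced state of the weight. -/
lemma weightMarginal_tensor_mul_tensor (hP : IsResolution P)
    (T : WithWeight ι →L[ℂ] WithWeight ι) (k l : κ) :
    weightMarginal (tensor (P k) 1 * T * tensor (P l) 1) =
      if k = l then weightMarginal (tensor (P k) 1 * T) else 0 := by
  rw [weightMarginal_mul_tensor_comm, ← mul_assoc, tensor_mul, hP.mul_eq, one_mul]
  by_cases h : k = l
  · simp [h]
  · rw [if_neg (Ne.symm h), if_neg h, tensor_zero_left, zero_mul]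
    exact Finset.sum_const_zero

/-- Only pairs of equal levels survive, so the weight ends in a sum of pinched states, each shifted
as a whole by a definite amount. -/
lemma weightMarginal_conj_star_ctrl (hP : IsResolution P) (E : κ → ℝ)
    (T : WithWeight ι →L[ℂ] WithWeight ι) :
    weightMarginal (star (ctrl P E) * T * ctrl P E) =
      ∑ k, shift (-E k) * pinchedMarginal (P k) T * star (shift (-E k)) := by
  have h1 : ∀ F : κ → ℝ, ctrl P F = ∑ k, tensor 1 (shift (F k)) * tensor (P k) 1 := fun F => by
    simp only [tensor_mul, one_mul, mul_one, ctrl]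
  have h2 : ctrl P E = ∑ k, tensor (P k) 1 * tensor 1 (shift (E k)) := by
    simp only [tensor_mul, one_mul, mul_one, ctrl]
  rw [star_ctrl hP, h1, h2, Finset.sum_mul, Finset.sum_mul_sum, weightMarginal_sum]
  refine Finset.sum_congr rfl fun k _ => ?_
  have h3 : ∀ l, tensor 1 (shift ((-E) k)) * tensor (P k) 1 * T *
      (tensor (P l) 1 * tensor 1 (shift (E l))) =
      tensor 1 (shift (-E k)) * (tensor (P k) 1 * T * tensor (P l) 1) *
        tensor 1 (shift (E l)) := fun l => by
    simp only [mul_assoc, Pi.neg_apply]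
  rw [weightMarginal_sum, Finset.sum_eq_single k]
  · rw [h3, weightMarginal_one_tensor_mul_mul, star_shift, neg_neg, pinchedMarginal, star_tensor,
      hP.isHermitian, star_one]
  · intro l _ hl
    rw [h3, weightMarginal_one_tensor_mul_mul, weightMarginal_tensor_mul_tensor hP, if_neg hl.symm]
    simp
  · simp

lemma sum_pinchedMarginal (hP : IsResolution P) (T : WithWeight ι →L[ℂ] WithWeight ι) :
    ∑ k, pinchedMarginal (P k) T = weightMarginal T := by
  simp only [pinchedMarginal, star_tensor, hP.isHermitian, star_one,
    weightMarginal_tensor_mul_tensor hP, if_true]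
  rw [← weightMarginal_sum, ← Finset.sum_mul, ← tensor_sum_left, hP.sum_eq, tensor_one_one,
    one_mul]

lemma isPositive_pinchedMarginal {T : WithWeight ι →L[ℂ] WithWeight ι} (hT : T.IsPositive)
    (Q : Matrix ι ι ℂ) : (pinchedMarginal Q T).IsPositive :=
  isPositive_weightMarginal (isPositive_mul_mul_star hT _)

lemma posTrace_pinchedMarginal_ne_top (hP : IsResolution P)
    {T : WithWeight ι →L[ℂ] WithWeight ι} (hT : T.IsPositive) (h : posTrace T ≠ ∞) (k : κ) :
    posTrace (pinchedMarginal (P k) T) ≠ ∞ := by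
  rw [← posTrace_weightMarginal hT, ← sum_pinchedMarginal hP,
    posTrace_sum fun k => isPositive_pinchedMarginal hT (P k)] at h
  exact ne_top_of_le_ne_top h (Finset.single_le_sum
    (f := fun k => posTrace (pinchedMarginal (P k) T)) (fun _ _ => zero_le) (Finset.mem_univ k))

/-- The mass of the k-th part of the weight is the probability of the level k in Tr_W T; this is how
the average energy of the system enters the balance. -/
lemma posTrace_pinchedMarginal_toReal (hP : IsResolution P)
    {T : WithWeight ι →L[ℂ] WithWeight ι} (hT : T.IsPositive) (h : posTrace T ≠ ∞) (k : κ) :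
    (posTrace (pinchedMarginal (P k) T)).toReal = (P k * traceOutWeight T).trace.re := by
  have hfin := posTrace_pinchedMarginal_ne_top hP hT h k
  have hpos := isPositive_mul_mul_star hT (tensor (P k) 1)
  rw [pinchedMarginal, posTrace_weightMarginal hpos] at *
  have h1 := trace_traceOutWeight hpos hfin
  rw [traceOutWeight_conj_tensor hT h, hP.isHermitian, Matrix.trace_mul_comm, ← mul_assoc,
    hP.mul_eq, if_pos rfl] at h1
  rw [h1, Complex.ofReal_re]

lemma sum_mul_posTrace_pinchedMarginal (hP : IsResolution P)
    {T : WithWeight ι →L[ℂ] WithWeight ι} (hT : T.IsPositive) (h : posTrace T ≠ ∞) (E : κ → ℝ) :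
    ∑ k, E k * (posTrace (pinchedMarginal (P k) T)).toReal =
      avgEnergy (∑ k, (E k : ℂ) • P k) (traceOutWeight T) := by
  rw [avgEnergy, Finset.sum_mul, Matrix.trace_sum, Complex.re_sum]
  refine Finset.sum_congr rfl fun k _ => ?_
  rw [posTrace_pinchedMarginal_toReal hP hT h, Matrix.smul_mul, Matrix.trace_smul, smul_eq_mul,
    Complex.re_ofReal_mul]

end Pinching

/-! ### The energy distribution of the weight -/

section Energy

/-- Distinct members are at distance √2, so the balls of radius 1/2 around them are disjoint open
sets in a separable space. Countability is needed to exchange the sum over the basis with integrals.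
-/
lemma countable_of_orthonormal {E κ : Type*} [NormedAddCommGroup E] [InnerProductSpace ℂ E]
    [TopologicalSpace.SeparableSpace E] {v : κ → E} (hv : Orthonormal ℂ v) : Countable κ := by
  refine Pairwise.countable_of_isOpen_disjoint (s := fun i => Metric.ball (v i) (1 / 2)) ?_
    (fun _ => Metric.isOpen_ball) (fun i => ⟨v i, Metric.mem_ball_self (by norm_num)⟩)
  intro i j hij
  refine Metric.ball_disjoint_ball ?_
  have h : ‖v i - v j‖ ^ 2 = 2 := by
    rw [@norm_sub_sq ℂ, hv.norm_eq_one, hv.norm_eq_one, hv.inner_eq_zero hij]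
    norm_num
  rw [dist_eq_norm]
  nlinarith [norm_nonneg (v i - v j)]

instance : Countable (basisSet Weight) :=
  have : Fact ((2 : ℝ≥0∞) ≠ ∞) := ⟨ENNReal.ofNat_ne_top⟩
  countable_of_orthonormal (basis Weight).orthonormal

/-- The energy distribution of a state of the weight, as a measure. -/
def energyMeasure (ρ : Weight →L[ℂ] Weight) : Measure ℝ := volume.withDensity (energyDensity ρ)

lemma measurable_enorm_sq (ψ : Weight) : Measurable fun ε => ‖ψ ε‖ₑ ^ 2 :=
  (Lp.stronglyMeasurable ψ).measurable.enorm.pow_const 2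

lemma measurable_energyDensity (ρ : Weight →L[ℂ] Weight) : Measurable (energyDensity ρ) :=
  Measurable.tsum fun _ => measurable_enorm_sq _

lemma enorm_sq_eq_lintegral {μ : Measure ℝ} (ψ : Lp ℂ 2 μ) :
    ‖ψ‖ₑ ^ 2 = ∫⁻ ε, ‖ψ ε‖ₑ ^ 2 ∂μ := by
  rw [Lp.enorm_def]
  have := eLpNorm_nnreal_pow_eq_lintegral (f := ψ) (μ := μ) (p := 2) (by norm_num)
  simpa using this

/-- Restriction of the energy to a set. -/
def restrictEnergy (A : Set ℝ) : Weight →L[ℂ] Lp ℂ 2 (volume.restrict A) :=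
  LpToLpRestrictCLM ℝ ℂ ℂ volume 2 A

lemma enorm_restrictEnergy_sq (A : Set ℝ) (ψ : Weight) :
    ‖restrictEnergy A ψ‖ₑ ^ 2 = ∫⁻ ε in A, ‖ψ ε‖ₑ ^ 2 := by
  rw [enorm_sq_eq_lintegral]
  refine lintegral_congr_ae ?_
  filter_upwards [LpToLpRestrictCLM_coeFn (p := 2) ℂ A ψ] with ε h
  rw [restrictEnergy, h]

lemma energyMeasure_apply (ρ : Weight →L[ℂ] Weight) {A : Set ℝ} (hA : MeasurableSet A) :
    energyMeasure ρ A = ∑' i, ‖restrictEnergy A (opSqrt ρ (basis Weight i))‖ₑ ^ 2 := by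
  rw [energyMeasure, withDensity_apply _ hA]
  simp only [energyDensity, enorm_restrictEnergy_sq]
  exact lintegral_tsum fun i => (measurable_enorm_sq _).aemeasurable

/-- The density is defined through √ρ, which is not additive in ρ. Passing to the adjoint of 1_A √ρ
expresses the measure by ρ itself, and additivity becomes visible. -/
lemma energyMeasure_apply_eq {ρ : Weight →L[ℂ] Weight} (hρ : ρ.IsPositive) {A : Set ℝ}
    (hA : MeasurableSet A) :
    energyMeasure ρ A = ∑' j, ENNReal.ofReal
      (inner ℂ (ContinuousLinearMap.adjoint (restrictEnergy A) (basis _ j))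
        (ρ (ContinuousLinearMap.adjoint (restrictEnergy A) (basis _ j)))).re := by
  rw [energyMeasure_apply ρ hA]
  have := tsum_enorm_sq_adjoint isParseval_basis isParseval_basis (restrictEnergy A ∘L opSqrt ρ)
  simp only [ContinuousLinearMap.comp_apply, ContinuousLinearMap.adjoint_comp, adjoint_opSqrt,
    enorm_opSqrt_apply_sq hρ] at this
  exact this

lemma energyMeasure_add {ρ ρ' : Weight →L[ℂ] Weight} (hρ : ρ.IsPositive) (hρ' : ρ'.IsPositive) :
    energyMeasure (ρ + ρ') = energyMeasure ρ + energyMeasure ρ' := by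
  ext A hA
  rw [Measure.add_apply, energyMeasure_apply_eq hρ hA, energyMeasure_apply_eq hρ' hA,
    energyMeasure_apply_eq (hρ.add hρ') hA, ← ENNReal.tsum_add]
  refine tsum_congr fun j => ?_
  rw [← ENNReal.ofReal_add (re_inner_apply_nonneg hρ _) (re_inner_apply_nonneg hρ' _),
    add_apply, inner_add_right, Complex.add_re]

lemma energyMeasure_zero : energyMeasure 0 = 0 := by
  ext A hA
  rw [energyMeasure_apply_eq ContinuousLinearMap.isPositive_zero hA]
  simp

lemma energyMeasure_sum {κ : Type*} (s : Finset κ) {ρ : κ → Weight →L[ℂ] Weight}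
    (hρ : ∀ k, (ρ k).IsPositive) :
    energyMeasure (∑ k ∈ s, ρ k) = ∑ k ∈ s, energyMeasure (ρ k) := by
  classical
  induction s using Finset.induction_on with
  | empty => simp [energyMeasure_zero]
  | insert a s ha ih =>
    rw [Finset.sum_insert ha, Finset.sum_insert ha, energyMeasure_add (hρ a), ih]
    exact ContinuousLinearMap.isPositive_sum _ fun k _ => hρ k

lemma lintegral_enorm_shift_sq (δ : ℝ) (ψ : Weight) {A : Set ℝ} (hA : MeasurableSet A) :
    ∫⁻ ε in A, ‖shift δ ψ ε‖ₑ ^ 2 = ∫⁻ ε in (fun ε => ε + δ) ⁻¹' A, ‖ψ ε‖ₑ ^ 2 := by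
  have h := (measurePreserving_sub_right volume δ).setLIntegral_comp_preimage
    (hA.preimage (measurable_add_const δ)) (measurable_enorm_sq ψ)
  rw [← h, ← Set.preimage_comp]
  have h2 : ((fun ε : ℝ => ε + δ) ∘ fun ε => ε - δ) = id := by
    ext; simp
  rw [h2, Set.preimage_id]
  refine lintegral_congr_ae (ae_restrict_of_ae ?_)
  filter_upwards [shift_coeFn δ ψ] with ε h
  rw [h]

lemma energyMeasure_shift {ρ : Weight →L[ℂ] Weight} (hρ : ρ.IsPositive) (δ : ℝ) :
    energyMeasure (shift δ * ρ * star (shift δ)) =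
      (energyMeasure ρ).map fun ε => ε + δ := by
  ext A hA
  rw [Measure.map_apply (measurable_add_const δ) hA,
    energyMeasure_apply_eq (isPositive_mul_mul_star hρ _) hA,
    energyMeasure_apply ρ (hA.preimage (measurable_add_const δ))]
  have := tsum_enorm_sq_adjoint isParseval_basis isParseval_basis
    ((restrictEnergy A ∘L shift δ) ∘L opSqrt ρ)
  simp only [ContinuousLinearMap.comp_apply, ContinuousLinearMap.adjoint_comp, adjoint_opSqrt,
    enorm_opSqrt_apply_sq hρ, enorm_restrictEnergy_sq, lintegral_enorm_shift_sq δ _ hA,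
    ContinuousLinearMap.adjoint_inner_left] at this
  simp only [enorm_restrictEnergy_sq, this, mul_apply_eq_comp, ContinuousLinearMap.star_eq_adjoint,
    ContinuousLinearMap.adjoint_inner_left]

lemma energyMeasure_univ {ρ : Weight →L[ℂ] Weight} (hρ : ρ.IsPositive) :
    energyMeasure ρ Set.univ = posTrace ρ := by
  rw [energyMeasure_apply ρ .univ, posTrace_eq_tsum_opSqrt hρ isParseval_basis]
  refine tsum_congr fun i => ?_
  rw [enorm_restrictEnergy_sq, Measure.restrict_univ, enorm_sq_eq_lintegral]

lemma hasFiniteEnergy_iff (ρ : Weight →L[ℂ] Weight) :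
    HasFiniteEnergy ρ ↔ Integrable (fun ε : ℝ => ε) (energyMeasure ρ) := by
  rw [Integrable, and_iff_right measurable_id'.aestronglyMeasurable, HasFiniteIntegral,
    energyMeasure, lintegral_withDensity_eq_lintegral_mul _ (measurable_energyDensity ρ)
      measurable_id'.enorm, HasFiniteEnergy]
  simp only [Pi.mul_apply, mul_comm]

/-- Finite trace makes the density finite almost everywhere, so `ENNReal.toReal` loses nothing. -/
lemma weightEnergy_eq {ρ : Weight →L[ℂ] Weight} (hρ : ρ.IsPositive) (h : posTrace ρ ≠ ∞) :
    weightEnergy ρ = ∫ ε, ε ∂energyMeasure ρ := by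
  have hfin : ∫⁻ ε, energyDensity ρ ε ≠ ∞ := by
    rwa [← energyMeasure_univ hρ, energyMeasure, withDensity_apply _ .univ,
      Measure.restrict_univ] at h
  rw [energyMeasure, integral_withDensity_eq_integral_toReal_smul (measurable_energyDensity ρ)
    (ae_lt_top (measurable_energyDensity ρ) hfin), weightEnergy]
  simp only [smul_eq_mul, mul_comm]

lemma isFiniteMeasure_energyMeasure {ρ : Weight →L[ℂ] Weight} (hρ : ρ.IsPositive)
    (h : posTrace ρ ≠ ∞) : IsFiniteMeasure (energyMeasure ρ) :=
  ⟨by rw [energyMeasure_univ hρ]; exact h.lt_top⟩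

variable {ι κ : Type*} [Fintype ι] [DecidableEq ι] [Fintype κ] [DecidableEq κ]
  {P : κ → Matrix ι ι ℂ}

lemma energyMeasure_weightMarginal (hP : IsResolution P) {T : WithWeight ι →L[ℂ] WithWeight ι}
    (hT : T.IsPositive) :
    energyMeasure (weightMarginal T) = ∑ k, energyMeasure (pinchedMarginal (P k) T) := by
  rw [← sum_pinchedMarginal hP, energyMeasure_sum _ fun k => isPositive_pinchedMarginal hT (P k)]

lemma energyMeasure_conj_star_ctrl (hP : IsResolution P) (E : κ → ℝ)
    {T : WithWeight ι →L[ℂ] WithWeight ι} (hT : T.IsPositive) :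
    energyMeasure (weightMarginal (star (ctrl P E) * T * ctrl P E)) =
      ∑ k, (energyMeasure (pinchedMarginal (P k) T)).map fun ε => ε + -E k := by
  rw [weightMarginal_conj_star_ctrl hP, energyMeasure_sum _ fun k =>
    isPositive_mul_mul_star (isPositive_pinchedMarginal hT (P k)) _]
  exact Finset.sum_congr rfl fun k _ => energyMeasure_shift (isPositive_pinchedMarginal hT (P k)) _

lemma integrable_map_add {μ : Measure ℝ} [IsFiniteMeasure μ] (c : ℝ) :
    Integrable (fun ε : ℝ => ε) (μ.map fun ε => ε + c) ↔ Integrable (fun ε : ℝ => ε) μ := by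
  rw [integrable_map_measure measurable_id'.aestronglyMeasurable (by fun_prop)]
  constructor
  · intro h
    exact (h.sub (integrable_const c)).congr (ae_of_all _ fun ε => by simp)
  · intro h
    exact h.add (integrable_const c)

lemma integral_map_add {μ : Measure ℝ} [IsFiniteMeasure μ] (c : ℝ)
    (h : Integrable (fun ε : ℝ => ε) μ) :
    ∫ ε, ε ∂(μ.map fun ε => ε + c) = ∫ ε, ε ∂μ + c * (μ Set.univ).toReal := by
  rw [integral_map (by fun_prop) measurable_id'.aestronglyMeasurable,
    integral_add h (integrable_const c), integral_const, smul_eq_mul, mul_comm]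
  rfl

/-- Both distributions are finite sums of the same finite measures up to translations, and
translating a finite measure does not affect integrability of ε. -/
lemma hasFiniteEnergy_conj_star_ctrl (hP : IsResolution P) (E : κ → ℝ)
    {T : WithWeight ι →L[ℂ] WithWeight ι} (hT : T.IsPositive) (h : posTrace T ≠ ∞) :
    HasFiniteEnergy (weightMarginal (star (ctrl P E) * T * ctrl P E)) ↔
      HasFiniteEnergy (weightMarginal T) := by
  rw [hasFiniteEnergy_iff, hasFiniteEnergy_iff, energyMeasure_conj_star_ctrl hP E hT,
    energyMeasure_weightMarginal hP hT, integrable_finsetSum_measure,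
    integrable_finsetSum_measure]
  refine forall₂_congr fun k _ => ?_
  have := isFiniteMeasure_energyMeasure (isPositive_pinchedMarginal hT (P k))
    (posTrace_pinchedMarginal_ne_top hP hT h k)
  exact integrable_map_add _

/-- The energy which the operator `∑ₖ Pₖ ⊗ Γ_(Eₖ)` transfers to the weight. -/
lemma weightEnergy_conj_star_ctrl (hP : IsResolution P) (E : κ → ℝ)
    {T : WithWeight ι →L[ℂ] WithWeight ι} (hT : T.IsPositive) (h : posTrace T ≠ ∞)
    (hE : HasFiniteEnergy (weightMarginal T)) :
    weightEnergy (weightMarginal (star (ctrl P E) * T * ctrl P E)) =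
      weightEnergy (weightMarginal T) -
        avgEnergy (∑ k, (E k : ℂ) • P k) (traceOutWeight T) := by
  have hfin := fun k => isFiniteMeasure_energyMeasure (isPositive_pinchedMarginal hT (P k))
    (posTrace_pinchedMarginal_ne_top hP hT h k)
  have hU : star (star (ctrl P E)) * star (ctrl P E) = 1 := by
    rw [star_star, ctrl_mul_star_self hP]
  have hpos : (star (ctrl P E) * T * ctrl P E).IsPositive := by
    simpa using isPositive_mul_mul_star hT (star (ctrl P E))
  have htr : posTrace (star (ctrl P E) * T * ctrl P E) = posTrace T := by
    simpa using posTrace_conj_of_isometry hT hU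
  rw [hasFiniteEnergy_iff, energyMeasure_weightMarginal hP hT, integrable_finsetSum_measure] at hE
  rw [weightEnergy_eq (isPositive_weightMarginal hpos)
      (by rwa [posTrace_weightMarginal hpos, htr]),
    weightEnergy_eq (isPositive_weightMarginal hT) (by rwa [posTrace_weightMarginal hT]),
    energyMeasure_conj_star_ctrl hP E hT, energyMeasure_weightMarginal hP hT,
    integral_finsetSum_measure hE, integral_finsetSum_measure fun k hk =>
      (integrable_map_add _).mpr (hE k hk), ← sum_mul_posTrace_pinchedMarginal hP hT h,
    ← Finset.sum_sub_distrib]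
  refine Finset.sum_congr rfl fun k hk => ?_
  rw [integral_map_add _ (hE k hk), energyMeasure_univ (isPositive_pinchedMarginal hT (P k))]
  ring

end Energy

/-! ### Ergotropy of finite-dimensional states -/

section Ergotropy

variable {ι : Type*} [Fintype ι] [DecidableEq ι]

lemma compactSpace_unitaryGroup : CompactSpace (Matrix.unitaryGroup ι ℂ) := by
  refine (isCompact_iff_compactSpace (s := (Matrix.unitaryGroup ι ℂ : Set (Matrix ι ι ℂ)))).mp ?_
  refine IsCompact.of_isClosed_subset (isCompact_univ_pi fun _ : ι => isCompact_univ_pi fun _ : ι =>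
    isCompact_closedBall (0 : ℂ) 1) ?_ ?_
  · have : ((Matrix.unitaryGroup ι ℂ : Set (Matrix ι ι ℂ))) = {V | V * star V = 1} :=
      Set.ext fun V => Matrix.mem_unitaryGroup_iff
    change IsClosed (Matrix.unitaryGroup ι ℂ : Set (Matrix ι ι ℂ))
    rw [this]
    exact isClosed_eq (by fun_prop) continuous_const
  · intro V hV a _ b _
    simpa using entry_norm_bound_of_unitary hV a b

/-- The energy is continuous on a compact group. The infimum in `passiveEnergy` is thus a minimum
over a set bounded below, not the default value of an unbounded real infimum. -/
lemma exists_isMinOn_energy (H ρ : Matrix ι ι ℂ) : ∃ V₀ : Matrix.unitaryGroup ι ℂ,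
    ∀ V : Matrix.unitaryGroup ι ℂ,
      ((V₀ : Matrix ι ι ℂ)ᴴ * H * (V₀ : Matrix ι ι ℂ) * ρ).trace.re ≤
        ((V : Matrix ι ι ℂ)ᴴ * H * (V : Matrix ι ι ℂ) * ρ).trace.re := by
  have := compactSpace_unitaryGroup (ι := ι)
  have hc : Continuous fun V : Matrix.unitaryGroup ι ℂ =>
      ((V : Matrix ι ι ℂ)ᴴ * H * (V : Matrix ι ι ℂ) * ρ).trace.re := by
    have hV : Continuous fun V : Matrix.unitaryGroup ι ℂ => (V : Matrix ι ι ℂ) :=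
      continuous_subtype_val
    exact Complex.continuous_re.comp
      (((hV.matrix_conjTranspose.mul continuous_const).mul hV).mul continuous_const).matrix_trace
  obtain ⟨V₀, -, h⟩ := isCompact_univ.exists_isMinOn Set.univ_nonempty hc.continuousOn
  exact ⟨V₀, fun V => h (Set.mem_univ V)⟩

lemma bddBelow_energy (H ρ : Matrix ι ι ℂ) : BddBelow (Set.range
    fun V : Matrix.unitaryGroup ι ℂ =>
      ((V : Matrix ι ι ℂ)ᴴ * H * (V : Matrix ι ι ℂ) * ρ).trace.re) := by
  obtain ⟨V₀, h⟩ := exists_isMinOn_energy H ρ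
  exact ⟨_, Set.forall_mem_range.mpr h⟩

/-- Right multiplication by V permutes the unitaries over which the infimum is taken. -/
lemma passiveEnergy_conj (H ρ : Matrix ι ι ℂ) {V : Matrix ι ι ℂ}
    (hV : V ∈ Matrix.unitaryGroup ι ℂ) : passiveEnergy H (V * ρ * Vᴴ) = passiveEnergy H ρ := by
  refine Equiv.iInf_congr (Equiv.mulRight ⟨V, hV⟩) fun W => ?_
  simp only [Equiv.coe_mulRight, Submonoid.coe_mul, Matrix.conjTranspose_mul]
  rw [show (W : Matrix ι ι ℂ)ᴴ * H * W * (V * ρ * Vᴴ) = (W : Matrix ι ι ℂ)ᴴ * H * W * V * ρ * Vᴴ by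
    simp only [mul_assoc], Matrix.trace_mul_comm _ Vᴴ]
  simp only [mul_assoc]

lemma ergotropy_sub_ergotropy_conj (H ρ : Matrix ι ι ℂ) {V : Matrix ι ι ℂ}
    (hV : V ∈ Matrix.unitaryGroup ι ℂ) :
    ergotropy H ρ - ergotropy H (V * ρ * Vᴴ) = avgEnergy H ρ - avgEnergy H (V * ρ * Vᴴ) := by
  rw [ergotropy, ergotropy, passiveEnergy_conj H ρ hV]
  ring

lemma ergotropy_nonneg (H ρ : Matrix ι ι ℂ) : 0 ≤ ergotropy H ρ := by
  have h := ciInf_le (bddBelow_energy H ρ) 1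
  simp only [OneMemClass.coe_one, Matrix.conjTranspose_one, one_mul, mul_one] at h
  exact sub_nonneg.mpr h

lemma exists_ergotropy_conj_eq_zero (H ρ : Matrix ι ι ℂ) :
    ∃ V ∈ Matrix.unitaryGroup ι ℂ, ergotropy H (V * ρ * Vᴴ) = 0 := by
  obtain ⟨V₀, h⟩ := exists_isMinOn_energy H ρ
  refine ⟨V₀, V₀.2, ?_⟩
  have h2 : passiveEnergy H ρ = ((V₀ : Matrix ι ι ℂ)ᴴ * H * (V₀ : Matrix ι ι ℂ) * ρ).trace.re :=
    le_antisymm (ciInf_le (bddBelow_energy H ρ) V₀) (le_ciInf h)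
  rw [ergotropy, passiveEnergy_conj H ρ V₀.2, h2, avgEnergy, ← mul_assoc, ← mul_assoc,
    Matrix.trace_mul_comm _ (V₀ : Matrix ι ι ℂ)ᴴ]
  simp only [mul_assoc, sub_self]

end Ergotropy

/-! ### The work of a dressed unitary -/

section Work

variable {n m : Type*} [Fintype n] [DecidableEq n] [Fintype m] [DecidableEq m]
  {H_S : Matrix n n ℂ} {H_B : Matrix m m ℂ} (hS : H_S.IsHermitian) (hB : H_B.IsHermitian)

lemma isResolution_eigenProjSB :
    IsResolution fun p : n × m => eigenProj hS p.1 ⊗ₖ eigenProj hB p.2 :=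
  (isResolution_eigenProj hS).kronecker (isResolution_eigenProj hB)

lemma sum_eigenvalues_smul_eigenProjSB :
    ∑ p : n × m, ((hS.eigenvalues p.1 + hB.eigenvalues p.2 : ℝ) : ℂ) •
      (eigenProj hS p.1 ⊗ₖ eigenProj hB p.2) = hamiltonianSB H_S H_B := by
  rw [sum_smul_kronecker (isResolution_eigenProj hS) (isResolution_eigenProj hB),
    sum_eigenvalues_smul_eigenProj, sum_eigenvalues_smul_eigenProj]

lemma star_controlShiftSB_mul_self :
    star (controlShiftSB hS hB) * controlShiftSB hS hB = 1 := by
  rw [controlShiftSB_eq_ctrl, star_ctrl_mul_self (isResolution_eigenProjSB hS hB)]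

lemma star_tensor_mul_self {ι : Type*} [Fintype ι] [DecidableEq ι] {V : Matrix ι ι ℂ}
    (hV : V ∈ Matrix.unitaryGroup ι ℂ) : star (tensor V 1) * tensor V 1 = 1 := by
  rw [star_tensor, tensor_mul, star_one, one_mul, unitary_conjTranspose_mul hV, tensor_one_one]

lemma weightMarginal_conj_tensor {ι : Type*} [Fintype ι] [DecidableEq ι] {V : Matrix ι ι ℂ}
    (hV : V ∈ Matrix.unitaryGroup ι ℂ) (T : WithWeight ι →L[ℂ] WithWeight ι) :
    weightMarginal (tensor V 1 * T * star (tensor V 1)) = weightMarginal T := by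
  rw [star_tensor, star_one, weightMarginal_mul_tensor_comm, ← mul_assoc, tensor_mul, one_mul,
    unitary_conjTranspose_mul hV, tensor_one_one, one_mul]

lemma dressed_one : dressed hS hB 1 = 1 := by
  rw [dressed, tensor_one_one, mul_one, star_controlShiftSB_mul_self]

lemma finalWeight_one {ι : Type*} [Fintype ι] [DecidableEq ι] (T : WithWeight ι →L[ℂ] WithWeight ι) :
    finalWeight 1 T = weightMarginal T := by
  rw [finalWeight, star_one, one_mul, mul_one]

lemma finalWeight_dressed (V : Matrix (n × m) (n × m) ℂ)
    (T : WithWeight (n × m) →L[ℂ] WithWeight (n × m)) :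
    finalWeight (dressed hS hB V) T = weightMarginal (star (controlShiftSB hS hB) *
      (tensor V 1 * (controlShiftSB hS hB * T * star (controlShiftSB hS hB)) *
        star (tensor V 1)) * controlShiftSB hS hB) := by
  simp only [finalWeight, dressed, star_mul, star_star, mul_assoc]

lemma hasFiniteEnergy_finalWeight_dressed_iff
    {T : WithWeight (n × m) →L[ℂ] WithWeight (n × m)} (hT : IsDensityOperator T)
    {V : Matrix (n × m) (n × m) ℂ} (hV : V ∈ Matrix.unitaryGroup (n × m) ℂ) :
    HasFiniteEnergy (finalWeight (dressed hS hB V) T) ↔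
      HasFiniteEnergy (weightMarginal
        (controlShiftSB hS hB * T * star (controlShiftSB hS hB))) := by
  rw [isDensityOperator_iff] at hT
  have h1 := isPositive_mul_mul_star hT.1 (controlShiftSB hS hB)
  have h2 := isPositive_mul_mul_star h1 (tensor V 1)
  have h3 : posTrace (controlShiftSB hS hB * T * star (controlShiftSB hS hB)) = 1 :=
    (posTrace_conj_of_isometry hT.1 (star_controlShiftSB_mul_self hS hB)).trans hT.2
  rw [finalWeight_dressed, controlShiftSB_eq_ctrl] at *
  rw [hasFiniteEnergy_conj_star_ctrl (isResolution_eigenProjSB hS hB) _ h2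
    (by rw [posTrace_conj_of_isometry h1 (star_tensor_mul_self hV), h3]; simp),
    weightMarginal_conj_tensor hV]

/-- Only the last factor Ŝ† exchanges energy with the weight after T' = Ŝ T Ŝ†: V ⊗ 1 leaves the
reduced state of the weight alone. The first term on the right does not depend on V. -/
lemma weightEnergy_finalWeight_dressed
    {T : WithWeight (n × m) →L[ℂ] WithWeight (n × m)} (hT : IsDensityOperator T)
    {V : Matrix (n × m) (n × m) ℂ} (hV : V ∈ Matrix.unitaryGroup (n × m) ℂ)
    (hE : HasFiniteEnergy (weightMarginal
      (controlShiftSB hS hB * T * star (controlShiftSB hS hB)))) :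
    weightEnergy (finalWeight (dressed hS hB V) T) =
      weightEnergy (weightMarginal (controlShiftSB hS hB * T * star (controlShiftSB hS hB))) -
        avgEnergy (hamiltonianSB H_S H_B) (V * traceOutWeight
          (controlShiftSB hS hB * T * star (controlShiftSB hS hB)) * Vᴴ) := by
  rw [isDensityOperator_iff] at hT
  have h1 := isPositive_mul_mul_star hT.1 (controlShiftSB hS hB)
  have h2 := isPositive_mul_mul_star h1 (tensor V 1)
  have h3 : posTrace (controlShiftSB hS hB * T * star (controlShiftSB hS hB)) = 1 :=
    (posTrace_conj_of_isometry hT.1 (star_controlShiftSB_mul_self hS hB)).trans hT.2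
  rw [← weightMarginal_conj_tensor hV] at hE
  have h4 := weightEnergy_conj_star_ctrl (isResolution_eigenProjSB hS hB)
    (fun p => hS.eigenvalues p.1 + hB.eigenvalues p.2) h2
    (by rw [posTrace_conj_of_isometry h1 (star_tensor_mul_self hV), h3]; simp) hE
  rw [← controlShiftSB_eq_ctrl, sum_eigenvalues_smul_eigenProjSB,
    traceOutWeight_conj_tensor h1 (by rw [h3]; simp), weightMarginal_conj_tensor hV] at h4
  rw [finalWeight_dressed, h4]

/-- Work is extracted from the ergotropy of the control-marginal state. -/
lemma work_dressed
    {T : WithWeight (n × m) →L[ℂ] WithWeight (n × m)} (hT : IsDensityOperator T)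
    {V : Matrix (n × m) (n × m) ℂ} (hV : V ∈ Matrix.unitaryGroup (n × m) ℂ)
    (hE : HasFiniteEnergy (weightMarginal T)) :
    HasFiniteEnergy (finalWeight (dressed hS hB V) T) ∧
      work (dressed hS hB V) T =
        ergotropy (hamiltonianSB H_S H_B)
          (traceOutWeight (controlShiftSB hS hB * T * star (controlShiftSB hS hB))) -
        ergotropy (hamiltonianSB H_S H_B) (V * traceOutWeight
          (controlShiftSB hS hB * T * star (controlShiftSB hS hB)) * Vᴴ) := by
  have h1 : (1 : Matrix (n × m) (n × m) ℂ) ∈ Matrix.unitaryGroup (n × m) ℂ := one_mem _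
  -- The initial state is treated as the final state for V = 1; the unknown weight energy of Ŝ T Ŝ†
  -- then cancels in the difference.
  rw [← finalWeight_one, ← dressed_one hS hB,
    hasFiniteEnergy_finalWeight_dressed_iff hS hB hT h1] at hE
  refine ⟨(hasFiniteEnergy_finalWeight_dressed_iff hS hB hT hV).mpr hE, ?_⟩
  rw [work, weightEnergy_finalWeight_dressed hS hB hT hV hE, ergotropy_sub_ergotropy_conj _ _ hV]
  have h2 := weightEnergy_finalWeight_dressed hS hB hT h1 hE
  rw [dressed_one, finalWeight_one, Matrix.conjTranspose_one, one_mul, mul_one] at h2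
  rw [h2]
  ring

end Work

/-! ### Time states and the averaged free evolution -/

section Time

/-- The phase `e^(-2πiδw)`. -/
def phase (δ w : ℝ) : ℂ := Complex.exp (-(2 * Real.pi * δ * w : ℝ) * Complex.I)

lemma continuous_phase (δ : ℝ) : Continuous (phase δ) := by
  unfold phase
  fun_prop

lemma norm_phase (δ w : ℝ) : ‖phase δ w‖ = 1 := by
  rw [phase, ← Complex.ofReal_neg, Complex.norm_exp_ofReal_mul_I]

lemma memLp_phase (δ : ℝ) : MemLp (phase δ) ∞ (volume : Measure ℝ) :=
  memLp_top_of_bound (continuous_phase δ).aestronglyMeasurable 1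
    (ae_of_all _ fun w => (norm_phase δ w).le)

/-- Multiplication by the phase `e^(-2πiδw)`. -/
def modulation (δ : ℝ) : Weight →L[ℂ] Weight :=
  (ContinuousLinearMap.mul ℂ ℂ).holderL volume ∞ 2 2 (memLp_phase δ).toLp

lemma modulation_coeFn (δ : ℝ) (ψ : Weight) :
    modulation δ ψ =ᵐ[volume] fun w => phase δ w * ψ w := by
  have h := (ContinuousLinearMap.mul ℂ ℂ).coeFn_holder (r := 2) (memLp_phase δ).toLp ψ
  filter_upwards [h, (memLp_phase δ).coeFn_toLp] with w h1 h2
  change ((ContinuousLinearMap.mul ℂ ℂ).holder 2 (memLp_phase δ).toLp ψ : Weight) w = _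
  rw [h1, h2]
  rfl

lemma fourier_shift_schwartz (δ : ℝ) (f : SchwartzMap ℝ ℂ) (w : ℝ) :
    (𝓕 (f.compSubConstCLM ℂ δ) : SchwartzMap ℝ ℂ) w = phase δ w * (𝓕 f : SchwartzMap ℝ ℂ) w := by
  rw [SchwartzMap.fourier_coe, SchwartzMap.fourier_coe]
  have h : 𝓕 (⇑(f.compSubConstCLM ℂ δ)) w = Real.fourierChar (inner ℝ (-δ) w) • 𝓕 (⇑f) w := by
    have h2 : ⇑(f.compSubConstCLM ℂ δ) = f ∘ fun v => v + -δ := by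
      ext v
      simp [sub_eq_add_neg]
    rw [h2]
    exact congrFun (VectorFourier.fourierIntegral_comp_add_right Real.fourierChar volume
      (innerₗ ℝ) f (-δ)) w
  rw [h, Circle.smul_def, smul_eq_mul, Real.fourierChar_apply, phase, Real.inner_apply]
  congr 2
  push_cast
  ring

/-- The Fourier transform turns shifts into modulations. -/
lemma fourier_shift (δ : ℝ) (ψ : Weight) : 𝓕 (shift δ ψ) = modulation δ (𝓕 ψ) := by
  have hd : DenseRange (SchwartzMap.toLpCLM ℝ ℂ 2 (volume : Measure ℝ)) :=
    SchwartzMap.denseRange_toLpCLM ENNReal.ofNat_ne_top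
  have hF : Continuous (fun ψ : Weight => 𝓕 ψ) := (Lp.fourierTransformₗᵢ ℝ ℂ).continuous
  -- Both sides are continuous in ψ, so it is enough to check Schwartz functions, where the Fourier
  -- transform is an integral.
  refine hd.induction_on (p := fun ψ => 𝓕 (shift δ ψ) = modulation δ (𝓕 ψ)) ψ
    (isClosed_eq (hF.comp (shift δ).continuous) ((modulation δ).continuous.comp hF)) fun f => ?_
  have h1 : shift δ (f.toLp 2) = (f.compSubConstCLM ℂ δ).toLp 2 := by
    apply Lp.ext
    have h := (measurePreserving_sub_right volume δ).quasiMeasurePreserving.ae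
      (f.coeFn_toLp 2 volume)
    filter_upwards [shift_coeFn δ (f.toLp 2), (f.compSubConstCLM ℂ δ).coeFn_toLp 2 volume, h]
      with ε h1 h2 h3
    rw [h1, h2, h3]
    rfl
  rw [SchwartzMap.toLpCLM_apply, h1, SchwartzMap.toLp_fourier_eq, SchwartzMap.toLp_fourier_eq]
  apply Lp.ext
  filter_upwards [modulation_coeFn δ ((𝓕 f).toLp 2), (𝓕 f).coeFn_toLp 2 volume,
    (𝓕 (f.compSubConstCLM ℂ δ)).coeFn_toLp 2 volume] with w h1 h2 h3
  rw [h1, h2, h3, fourier_shift_schwartz]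

lemma star_phase_mul (a b w : ℝ) : (starRingEnd ℂ) (phase a w) * phase b w = phase (b - a) w := by
  rw [phase, phase, phase, ← Complex.exp_conj, ← Complex.exp_add]
  congr 1
  simp only [map_mul, map_neg, Complex.conj_ofReal, Complex.conj_I]
  push_cast
  ring

lemma inner_shift_shift (a b : ℝ) (ψ : Weight) :
    inner ℂ (shift a ψ) (shift b ψ) =
      ∫ w, ((‖(𝓕 ψ : Weight) w‖ ^ 2 : ℝ) : ℂ) * phase (b - a) w := by
  rw [← Lp.inner_fourier_eq, fourier_shift, fourier_shift, L2.inner_def]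
  refine integral_congr_ae ?_
  filter_upwards [modulation_coeFn a (𝓕 ψ), modulation_coeFn b (𝓕 ψ)] with w h1 h2
  rw [h1, h2, ← star_phase_mul]
  simp only [RCLike.inner_apply, map_mul]
  rw [Complex.ofReal_pow, ← Complex.conj_mul']
  ring

/-- The distribution of a state over the Fourier frequencies. -/
def frequencyDensity (ρ : Weight →L[ℂ] Weight) (w : ℝ) : ℝ≥0∞ :=
  ∑' i, ‖(𝓕 (opSqrt ρ (basis Weight i)) : Weight) w‖ₑ ^ 2

lemma measurable_frequencyDensity (ρ : Weight →L[ℂ] Weight) : Measurable (frequencyDensity ρ) :=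
  Measurable.tsum fun _ => measurable_enorm_sq _

lemma lintegral_frequencyDensity {ρ : Weight →L[ℂ] Weight} (hρ : ρ.IsPositive) :
    ∫⁻ w, frequencyDensity ρ w = posTrace ρ := by
  rw [posTrace_eq_tsum_opSqrt hρ isParseval_basis]
  unfold frequencyDensity
  rw [lintegral_tsum fun i => (measurable_enorm_sq _).aemeasurable]
  refine tsum_congr fun i => ?_
  rw [← enorm_sq_eq_lintegral, enorm_sq_eq_ofReal, Lp.norm_fourier_eq, enorm_sq_eq_ofReal]

lemma toReal_frequencyDensity (ρ : Weight →L[ℂ] Weight) (w : ℝ) :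
    (frequencyDensity ρ w).toReal = ∑' i, ‖(𝓕 (opSqrt ρ (basis Weight i)) : Weight) w‖ ^ 2 := by
  rw [frequencyDensity, ENNReal.tsum_toReal_eq fun i => by simp]
  simp [ENNReal.toReal_pow]

lemma toReal_timeDensity (ρ : Weight →L[ℂ] Weight) (t : ℝ) :
    (timeDensity ρ t).toReal =
      (2 * Real.pi)⁻¹ * (frequencyDensity ρ (t / (2 * Real.pi))).toReal := by
  rw [timeDensity, ENNReal.toReal_mul, ENNReal.toReal_ofReal (by positivity), frequencyDensity]

lemma integrable_frequencyDensity {ρ : Weight →L[ℂ] Weight} (hρ : ρ.IsPositive)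
    (h : posTrace ρ ≠ ∞) : Integrable fun w => (frequencyDensity ρ w).toReal :=
  integrable_toReal_of_lintegral_ne_top (measurable_frequencyDensity ρ).aemeasurable
    (by rwa [lintegral_frequencyDensity hρ])

lemma integral_frequencyDensity {ρ : Weight →L[ℂ] Weight} (hρ : ρ.IsPositive)
    (h : posTrace ρ ≠ ∞) : ∫ w, (frequencyDensity ρ w).toReal = (posTrace ρ).toReal := by
  rw [integral_toReal (measurable_frequencyDensity ρ).aemeasurable, lintegral_frequencyDensity hρ]
  exact ae_lt_top (measurable_frequencyDensity ρ) (by rwa [lintegral_frequencyDensity hρ])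

lemma integrable_timeDensity {ρ : Weight →L[ℂ] Weight} (hρ : IsDensityOperator ρ) :
    Integrable fun t => (timeDensity ρ t).toReal := by
  rw [isDensityOperator_iff] at hρ
  simp only [toReal_timeDensity]
  exact ((integrable_frequencyDensity hρ.1 (by simp [hρ.2])).comp_div
    (by positivity)).const_mul _

/-- The substitution t = 2πw; the prefactor (2π)⁻¹ of the time density cancels its Jacobian. -/
lemma integral_timeDensity_mul (ρ : Weight →L[ℂ] Weight) (g : ℝ → ℂ) :
    ∫ t, ((timeDensity ρ t).toReal : ℂ) * g (t / (2 * Real.pi)) =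
      ∫ w, ((frequencyDensity ρ w).toReal : ℂ) * g w := by
  have h := Measure.integral_comp_div (fun w => ((frequencyDensity ρ w).toReal : ℂ) * g w)
    (2 * Real.pi)
  simp only [toReal_timeDensity]
  push_cast
  simp only [mul_assoc]
  rw [integral_const_mul, h, abs_of_pos Real.two_pi_pos, Complex.real_smul]
  push_cast
  field_simp

lemma integral_timeDensity {ρ : Weight →L[ℂ] Weight} (hρ : IsDensityOperator ρ) :
    ∫ t, (timeDensity ρ t).toReal = 1 := by
  rw [isDensityOperator_iff] at hρ
  have h := Measure.integral_comp_div (fun w => (frequencyDensity ρ w).toReal) (2 * Real.pi)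
  simp only [toReal_timeDensity]
  rw [integral_const_mul, h, abs_of_pos Real.two_pi_pos,
    integral_frequencyDensity hρ.1 (by simp [hρ.2]), hρ.2, smul_eq_mul, ENNReal.toReal_one, mul_one,
    inv_mul_cancel₀ Real.two_pi_pos.ne']

/-- Each term is the integral of |φ_i|² against a phase, φ_i being the Fourier transform of √ρ b_i.
Since ∑ᵢ ‖φ_i‖² is the finite trace of ρ, sum and integral may be exchanged. -/
lemma hasSum_inner_shift_opSqrt {ρ : Weight →L[ℂ] Weight} (hρ : IsDensityOperator ρ) (a b : ℝ) :
    HasSum (fun i => inner ℂ (shift a (opSqrt ρ (basis Weight i)))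
        (shift b (opSqrt ρ (basis Weight i))))
      (∫ w, ((frequencyDensity ρ w).toReal : ℂ) * phase (b - a) w) := by
  rw [isDensityOperator_iff] at hρ
  set φ : basisSet Weight → Weight := fun i => 𝓕 (opSqrt ρ (basis Weight i))
  have hint : ∀ i, Integrable fun w => ‖φ i w‖ ^ 2 := fun i =>
    (memLp_two_iff_integrable_sq_norm (Lp.aestronglyMeasurable (φ i))).mp (Lp.memLp (φ i))
  have hsum : Summable fun i => ‖φ i‖ ^ 2 := by
    apply summable_norm_sq
    have h : ∑' i, ‖opSqrt ρ (basis Weight i)‖ₑ ^ 2 ≠ ∞ := by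
      rw [← posTrace_eq_tsum_opSqrt hρ.1 isParseval_basis, hρ.2]
      simp
    simpa only [φ, enorm_sq_eq_ofReal, Lp.norm_fourier_eq] using h
  have hnorm : ∀ i, ‖φ i‖ ^ 2 = ∫ w, ‖φ i w‖ ^ 2 := by
    intro i
    have := L2.inner_def (𝕜 := ℂ) (φ i) (φ i)
    rw [inner_self_eq_norm_sq_to_K] at this
    simp only [inner_self_eq_norm_sq_to_K] at this
    have h2 : (((‖φ i‖ ^ 2 : ℝ)) : ℂ) = ((∫ w, ‖φ i w‖ ^ 2 : ℝ) : ℂ) := by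
      rw [← integral_complex_ofReal]
      simpa using this
    exact_mod_cast h2
  have key := hasSum_integral_of_summable_integral_norm
    (F := fun i w => ((‖φ i w‖ ^ 2 : ℝ) : ℂ) * phase (b - a) w) (μ := volume)
    (fun i => (hint i).ofReal.mul_bdd (continuous_phase _).aestronglyMeasurable
      (c := 1) (ae_of_all _ fun w => (norm_phase _ w).le)) ?_
  · simp only [inner_shift_shift]
    have h : ∀ w, ((frequencyDensity ρ w).toReal : ℂ) * phase (b - a) w =
        ∑' i, ((‖φ i w‖ ^ 2 : ℝ) : ℂ) * phase (b - a) w := fun w => by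
      simp only [tsum_mul_right, ← Complex.ofReal_tsum, toReal_frequencyDensity, φ]
    simp only [h]
    exact key
  · refine hsum.congr fun i => ?_
    rw [hnorm]
    refine integral_congr_ae (ae_of_all _ fun w => ?_)
    simp [norm_phase]

/-- Here Γ_a ρ Γ_b† = A†B with A = √ρ Γ_a† and B = √ρ Γ_b†. Exchanging the factors gives inner
products of shifted vectors, with a and b in reversed order. -/
lemma hasSum_inner_shift_conj {ρ : Weight →L[ℂ] Weight} (hρ : IsDensityOperator ρ) (a b : ℝ) :
    HasSum (fun i => inner ℂ (basis Weight i)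
        ((shift a * ρ * star (shift b)) (basis Weight i)))
      (∫ t, ((timeDensity ρ t).toReal : ℂ) * Complex.exp (-(Complex.I * t) * (a - b : ℝ))) := by
  have hρ' := isDensityOperator_iff.mp hρ
  have hfin : ∀ δ, ∑' i, ‖(opSqrt ρ ∘L star (shift δ)) (basis Weight i)‖ₑ ^ 2 ≠ ∞ := by
    intro δ
    rw [tsum_enorm_sq_adjoint isParseval_basis isParseval_basis]
    simp only [ContinuousLinearMap.adjoint_comp, adjoint_opSqrt,
      ContinuousLinearMap.star_eq_adjoint, ContinuousLinearMap.adjoint_adjoint,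
      ContinuousLinearMap.comp_apply, enorm_sq_eq_ofReal, norm_shift]
    simp only [← enorm_sq_eq_ofReal]
    rw [← posTrace_eq_tsum_opSqrt hρ'.1 isParseval_basis, hρ'.2]
    simp
  have h1 := hasSum_inner_adjoint_comp (basis Weight) (basis Weight) _ _ (hfin a) (hfin b)
  simp only [ContinuousLinearMap.adjoint_comp, adjoint_opSqrt,
      ContinuousLinearMap.star_eq_adjoint, ContinuousLinearMap.adjoint_adjoint,
      ContinuousLinearMap.comp_apply] at h1
  rw [(hasSum_inner_shift_opSqrt hρ b a).tsum_eq, ← integral_timeDensity_mul] at h1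
  convert h1 using 1
  · ext i
    rw [inner_opSqrt_apply hρ'.1, ContinuousLinearMap.adjoint_inner_left]
    rfl
  · congr! 4 with t
    rw [phase]
    congr 1
    have := Real.pi_pos.ne'
    push_cast
    field_simp

variable {n : Type*} [Fintype n] [DecidableEq n]

lemma conjTranspose_evolution {H : Matrix n n ℂ} (hH : H.IsHermitian) (t : ℝ) :
    (evolution H t)ᴴ = NormedSpace.exp ((Complex.I * t) • H) := by
  rw [evolution, ← Matrix.exp_conjTranspose, Matrix.conjTranspose_smul, hH.eq]
  simp

lemma evolution_conj {H : Matrix n n ℂ} (hH : H.IsHermitian) (t : ℝ) (A : Matrix n n ℂ) :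
    evolution H t * A * (evolution H t)ᴴ = ∑ k, ∑ l,
      Complex.exp (-(Complex.I * t) * (hH.eigenvalues k - hH.eigenvalues l : ℝ)) •
        (eigenProj hH k * A * eigenProj hH l) := by
  rw [conjTranspose_evolution hH, evolution, exp_smul_eq_sum hH, exp_smul_eq_sum hH,
    Finset.sum_mul, Finset.sum_mul_sum]
  refine Finset.sum_congr rfl fun k _ => Finset.sum_congr rfl fun l _ => ?_
  rw [Matrix.smul_mul, Matrix.smul_mul, Matrix.mul_smul, smul_smul, ← Complex.exp_add]
  congr 2
  push_cast
  ring

lemma controlShift_conj_tensor {H : Matrix n n ℂ} (hH : H.IsHermitian) (A : Matrix n n ℂ)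
    (T : Weight →L[ℂ] Weight) :
    controlShift hH * tensor A T * star (controlShift hH) = ∑ k, ∑ l,
      tensor (eigenProj hH k * A * eigenProj hH l)
        (shift (hH.eigenvalues k) * T * star (shift (hH.eigenvalues l))) := by
  rw [controlShift, ContinuousLinearMap.star_eq_adjoint, map_sum, Finset.sum_mul,
    Finset.sum_mul_sum]
  simp only [← ContinuousLinearMap.star_eq_adjoint, star_tensor,
    (isResolution_eigenProj hH).isHermitian, tensor_mul]

/-- For a product state, the control-marginal state is a time average of the free evolution. -/
lemma controlMarginal_tensor {H : Matrix n n ℂ} (hH : H.IsHermitian) (A : Matrix n n ℂ)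
    {ρ : Weight →L[ℂ] Weight} (hρ : IsDensityOperator ρ) :
    controlMarginal hH (tensor A ρ) = Matrix.of fun a b =>
      ∫ t, ((timeDensity ρ t).toReal : ℂ) * (evolution H t * A * (evolution H t)ᴴ) a b := by
  ext a b
  rw [controlMarginal, controlShift_conj_tensor, traceOutWeight, Matrix.of_apply, Matrix.of_apply,
    opTrace]
  refine HasSum.tsum_eq ?_
  simp only [evolution_conj hH, Matrix.sum_apply, Matrix.smul_apply, Finset.mul_sum, block_sum,
    block_tensor, sum_apply, smul_apply, inner_sum, inner_smul_right, smul_eq_mul]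
  have hint : ∀ k l, Integrable fun t : ℝ => ((timeDensity ρ t).toReal : ℂ) *
      (Complex.exp (-(Complex.I * t) * (hH.eigenvalues k - hH.eigenvalues l : ℝ)) *
        (eigenProj hH k * A * eigenProj hH l) a b) := by
    intro k l
    simp only [← mul_assoc]
    refine Integrable.mul_const ?_ _
    refine (integrable_timeDensity hρ).ofReal.mul_bdd (c := 1)
      (Continuous.aestronglyMeasurable (by fun_prop)) (ae_of_all _ fun t => ?_)
    rw [show -(Complex.I * t) * ((hH.eigenvalues k - hH.eigenvalues l : ℝ) : ℂ) =
      ((-t * (hH.eigenvalues k - hH.eigenvalues l) : ℝ) : ℂ) * Complex.I by push_cast; ring,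
      Complex.norm_exp_ofReal_mul_I]
  rw [integral_finsetSum _ fun k _ => integrable_finsetSum _ fun l _ => hint k l]
  refine hasSum_sum fun k _ => ?_
  rw [integral_finsetSum _ fun l _ => hint k l]
  refine hasSum_sum fun l _ => ?_
  simp only [← mul_assoc]
  rw [integral_mul_const, mul_comm]
  exact (hasSum_inner_shift_conj hρ _ _).mul_left _

end Time

/-! ### Operators commuting with the energy and the shifts -/

section Commutant

/-- The indicator function of the interval `(a, b]`. -/
def chi (a b : ℝ) : Weight :=
  indicatorConstLp 2 (measurableSet_Ioc (a := a) (b := b)) measure_Ioc_lt_top.ne (1 : ℂ)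

lemma chi_coeFn (a b : ℝ) :
    chi a b =ᵐ[volume] (Set.Ioc a b).indicator fun _ => (1 : ℂ) := indicatorConstLp_coeFn

lemma inner_chi (a b : ℝ) (ψ : Weight) : inner ℂ (chi a b) ψ = ∫ ε in Set.Ioc a b, ψ ε :=
  L2.inner_indicatorConstLp_one _ _ ψ

lemma chi_eq_zero {a b : ℝ} (h : b ≤ a) : chi a b = 0 := by
  apply Lp.ext
  filter_upwards [chi_coeFn a b, Lp.coeFn_zero ℂ 2 (volume : Measure ℝ)] with ε h1 h2
  rw [h1, h2, Set.Ioc_eq_empty (not_lt.mpr h)]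
  simp

lemma chi_add {a b c : ℝ} (h : a ≤ b) (h' : b ≤ c) : chi a b + chi b c = chi a c := by
  apply Lp.ext
  filter_upwards [Lp.coeFn_add (chi a b) (chi b c), chi_coeFn a b, chi_coeFn b c, chi_coeFn a c]
    with ε h1 h2 h3 h4
  rw [h1, Pi.add_apply, h2, h3, h4, ← Set.Ioc_union_Ioc_eq_Ioc h h', Set.indicator_union_of_disjoint]
  exact Set.Ioc_disjoint_Ioc_of_le le_rfl

lemma shift_chi (δ a b : ℝ) : shift δ (chi a b) = chi (a + δ) (b + δ) := by
  apply Lp.ext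
  have h := (measurePreserving_sub_right volume δ).quasiMeasurePreserving.ae (chi_coeFn a b)
  filter_upwards [shift_coeFn δ (chi a b), chi_coeFn (a + δ) (b + δ), h] with ε h1 h2 h3
  rw [h1, h2, h3]
  simp only [Set.indicator_apply, Set.mem_Ioc, lt_sub_iff_add_lt, sub_le_iff_le_add]

lemma locallyIntegrable_weight (ψ : Weight) : LocallyIntegrable ψ volume :=
  (Lp.memLp ψ).locallyIntegrable (by norm_num)

/-- Lebesgue's differentiation theorem. -/
lemma ae_tendsto_inner_chi (ψ : Weight) : ∀ᵐ x : ℝ, Filter.Tendsto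
    (fun h : ℝ => h⁻¹ • inner ℂ (chi x (x + h)) ψ) (nhdsWithin 0 (Set.Ioi 0)) (nhds (ψ x)) := by
  filter_upwards [LocallyIntegrable.ae_hasDerivAt_integral (locallyIntegrable_weight ψ)] with x hx
  refine (hx x).tendsto_slope_zero_right.congr' ?_
  filter_upwards [self_mem_nhdsWithin] with h hh
  rw [intervalIntegral.integral_same, sub_zero, inner_chi,
    intervalIntegral.integral_of_le (le_add_of_nonneg_right (le_of_lt hh))]

/-- By Lebesgue differentiation ψ is almost everywhere the limit of its averages over (x, x + h],
all of which vanish. -/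
lemma eq_zero_of_inner_chi {ψ : Weight} (h : ∀ a b, inner ℂ (chi a b) ψ = 0) : ψ = 0 := by
  apply Lp.ext
  filter_upwards [ae_tendsto_inner_chi ψ, Lp.coeFn_zero ℂ 2 (volume : Measure ℝ)] with x h1 h2
  rw [h2]
  simp only [h, smul_zero] at h1
  exact tendsto_nhds_unique h1 tendsto_const_nhds

lemma memLp_chiPow (N : ℝ) (k : ℕ) :
    MemLp ((Set.Ioc (-N) N).indicator fun ε : ℝ => (ε : ℂ) ^ k) 2 volume := by
  rw [memLp_indicator_iff_restrict measurableSet_Ioc]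
  have : IsFiniteMeasure (volume.restrict (Set.Ioc (-N) N)) :=
    ⟨by rw [Measure.restrict_apply_univ]; exact measure_Ioc_lt_top⟩
  refine MemLp.of_bound (Continuous.aestronglyMeasurable (by fun_prop)) (N ^ k) ?_
  filter_upwards [ae_restrict_mem measurableSet_Ioc] with ε hε
  rw [norm_pow, Complex.norm_real]
  exact pow_le_pow_left₀ (norm_nonneg _) (abs_le.mpr ⟨hε.1.le, hε.2⟩) k

/-- The function `ε ^ k` on the interval `(-N, N]`. -/
def chiPow (N : ℝ) (k : ℕ) : Weight := (memLp_chiPow N k).toLp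

lemma chiPow_coeFn (N : ℝ) (k : ℕ) :
    chiPow N k =ᵐ[volume] (Set.Ioc (-N) N).indicator fun ε : ℝ => (ε : ℂ) ^ k :=
  (memLp_chiPow N k).coeFn_toLp

lemma chiPow_zero (N : ℝ) : chiPow N 0 = chi (-N) N := by
  apply Lp.ext
  filter_upwards [chiPow_coeFn N 0, chi_coeFn (-N) N] with ε h1 h2
  rw [h1, h2]
  simp

lemma mul_chiPow_ae (N : ℝ) (k : ℕ) :
    (fun ε : ℝ => (ε : ℂ) * chiPow N k ε) =ᵐ[volume] chiPow N (k + 1) := by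
  filter_upwards [chiPow_coeFn N k, chiPow_coeFn N (k + 1)] with ε h1 h2
  rw [h1, h2]
  simp only [Set.indicator_apply]
  split_ifs
  · rw [pow_succ']
  · simp

lemma chiPow_mem_domain (N : ℝ) (k : ℕ) : chiPow N k ∈ weightHamiltonian.domain :=
  (memLp_congr_ae (mul_chiPow_ae N k)).mpr (Lp.memLp _)

lemma weightHamiltonian_coeFn (ψ : weightHamiltonian.domain) :
    weightHamiltonian ψ =ᵐ[volume] fun ε : ℝ => (ε : ℂ) * (ψ : Weight) ε :=
  MemLp.coeFn_toLp (f := fun ε : ℝ => (ε : ℂ) * (ψ : Weight) ε) ψ.2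

lemma weightHamiltonian_chiPow (N : ℝ) (k : ℕ) :
    weightHamiltonian ⟨chiPow N k, chiPow_mem_domain N k⟩ = chiPow N (k + 1) :=
  Lp.ext ((weightHamiltonian_coeFn _).trans (mul_chiPow_ae N k))

lemma norm_chiPow_le (N : ℝ) (k : ℕ) : ‖chiPow N k‖ ≤ N ^ k * ‖chiPow N 0‖ := by
  refine Lp.norm_le_mul_norm_of_ae_le_mul ?_
  filter_upwards [chiPow_coeFn N 0, chiPow_coeFn N k] with ε h1 h2
  rw [h1, h2]
  simp only [Set.indicator_apply]
  split_ifs with hε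
  · rw [norm_pow, Complex.norm_real, pow_zero, norm_one, mul_one]
    exact pow_le_pow_left₀ (norm_nonneg _) (abs_le.mpr ⟨hε.1.le, hε.2⟩) k
  · simp

/-- The operator commutes with the Hamiltonian of the weight. -/
def CommutesWithEnergy (t : Weight →L[ℂ] Weight) : Prop :=
  ∀ ψ : weightHamiltonian.domain, ∃ h : t ψ ∈ weightHamiltonian.domain,
    weightHamiltonian ⟨t ψ, h⟩ = t (weightHamiltonian ψ)

variable {t : Weight →L[ℂ] Weight}

/-- Commutation with H_W, iterated on bounded intervals, where all powers of the energy stay in the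
domain. -/
lemma CommutesWithEnergy.apply_chiPow (ht : CommutesWithEnergy t) (N : ℝ) (k : ℕ) :
    t (chiPow N k) =ᵐ[volume] fun ε : ℝ => (ε : ℂ) ^ k * t (chiPow N 0) ε := by
  induction k with
  | zero => simp
  | succ k ih =>
    obtain ⟨h, h'⟩ := ht ⟨chiPow N k, chiPow_mem_domain N k⟩
    rw [weightHamiltonian_chiPow] at h'
    rw [← h']
    filter_upwards [weightHamiltonian_coeFn ⟨t (chiPow N k), h⟩, ih] with ε h1 h2
    rw [h1, h2]
    ring

/-- Let g = tχ with χ supported in [-N, N]. Then ε^k g = t(ε^k χ) has norm at most ‖t‖ N^k ‖χ‖,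
whereas on |ε| ≥ M it is at least M^k |g|. So the part of g there has norm O((N/M)^k) for every k
and vanishes. This replaces the functional calculus of H_W. -/
lemma CommutesWithEnergy.ae_eq_zero_of_le_abs (ht : CommutesWithEnergy t) {N M : ℝ} (hN : 0 ≤ N)
    (hM : N < M) : ∀ᵐ ε : ℝ, M ≤ |ε| → t (chi (-N) N) ε = 0 := by
  set g := t (chiPow N 0)
  have hA : MeasurableSet {ε : ℝ | M ≤ |ε|} := measurableSet_le measurable_const (by fun_prop)
  have hg := (Lp.memLp g).indicator hA
  have hM0 : 0 < M := hN.trans_lt hM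
  have hbound : ∀ k : ℕ, ‖hg.toLp‖ ≤ (‖t‖ * ‖chiPow N 0‖) * (N / M) ^ k := by
    intro k
    have h1 : ‖hg.toLp‖ ≤ (M ^ k)⁻¹ * ‖t (chiPow N k)‖ := by
      refine Lp.norm_le_mul_norm_of_ae_le_mul ?_
      filter_upwards [hg.coeFn_toLp, ht.apply_chiPow N k] with ε h1 h2
      rw [h1, h2]
      simp only [Set.indicator_apply, Set.mem_ofPred_eq]
      split_ifs with hε
      · rw [norm_mul, norm_pow, Complex.norm_real, ← mul_assoc]
        refine le_mul_of_one_le_left (norm_nonneg _) ?_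
        rw [inv_mul_eq_div, one_le_div (by positivity)]
        exact pow_le_pow_left₀ hM0.le hε k
      · simp only [norm_zero]
        positivity
    refine h1.trans ?_
    have h2 : ‖t (chiPow N k)‖ ≤ ‖t‖ * (N ^ k * ‖chiPow N 0‖) :=
      (t.le_opNorm _).trans (by gcongr; exact norm_chiPow_le N k)
    calc (M ^ k)⁻¹ * ‖t (chiPow N k)‖ ≤ (M ^ k)⁻¹ * (‖t‖ * (N ^ k * ‖chiPow N 0‖)) := by gcongr
      _ = _ := by rw [div_pow]; ring
  have hlim : Filter.Tendsto (fun k : ℕ => (‖t‖ * ‖chiPow N 0‖) * (N / M) ^ k) Filter.atTop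
      (nhds 0) := by
    simpa using (tendsto_pow_atTop_nhds_zero_of_lt_one (by positivity)
      ((div_lt_one hM0).mpr hM)).const_mul (‖t‖ * ‖chiPow N 0‖)
  have h0 : hg.toLp = 0 := norm_le_zero_iff.mp (ge_of_tendsto' hlim hbound)
  have h1 := hg.coeFn_toLp
  rw [h0] at h1
  filter_upwards [h1, Lp.coeFn_zero ℂ 2 (volume : Measure ℝ)] with ε h2 h3 hε
  rw [h2, Set.indicator_of_mem (by exact hε)] at h3
  rw [← chiPow_zero]
  exact h3

lemma CommutesWithEnergy.ae_eq_zero_symm (ht : CommutesWithEnergy t) {N : ℝ} (hN : 0 ≤ N) :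
    ∀ᵐ ε : ℝ, ε ∉ Set.Ioc (-N) N → t (chi (-N) N) ε = 0 := by
  have h1 : ∀ j : ℕ, ∀ᵐ ε : ℝ, N + 1 / ((j : ℝ) + 1) ≤ |ε| → t (chi (-N) N) ε = 0 := fun j =>
    ht.ae_eq_zero_of_le_abs hN (lt_add_of_pos_right _ Nat.one_div_pos_of_nat)
  -- The endpoint -N lies outside the half-open interval although |ε| = N there; it is discarded as
  -- a null set.
  filter_upwards [ae_all_iff.mpr h1, compl_mem_ae_iff.mpr (measure_singleton (-N))] with ε h2 h3 h4
  have h5 : N < |ε| := by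
    by_contra! h
    rw [abs_le] at h
    exact h4 ⟨lt_of_le_of_ne h.1 (Ne.symm h3), h.2⟩
  obtain ⟨j, hj⟩ := exists_nat_one_div_lt (sub_pos.mpr h5)
  exact h2 j (by linarith)

lemma apply_shift (hΓ : ∀ δ, t * shift δ = shift δ * t) (δ : ℝ) (ψ : Weight) :
    t (shift δ ψ) = shift δ (t ψ) := congrArg (fun A : Weight →L[ℂ] Weight => A ψ) (hΓ δ)

lemma CommutesWithEnergy.ae_eq_zero (ht : CommutesWithEnergy t)
    (hΓ : ∀ δ, t * shift δ = shift δ * t) (a b : ℝ) :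
    ∀ᵐ ε : ℝ, ε ∉ Set.Ioc a b → t (chi a b) ε = 0 := by
  rcases le_or_gt b a with h | h
  · rw [chi_eq_zero h, map_zero]
    filter_upwards [Lp.coeFn_zero ℂ 2 (volume : Measure ℝ)] with ε h1 _ using h1
  · have h1 : chi a b = shift ((a + b) / 2) (chi (-((b - a) / 2)) ((b - a) / 2)) := by
      rw [shift_chi]
      congr 1 <;> ring
    rw [h1, apply_shift hΓ]
    have h2 := (measurePreserving_sub_right volume ((a + b) / 2)).quasiMeasurePreserving.ae
      (ht.ae_eq_zero_symm (N := (b - a) / 2) (by linarith))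
    filter_upwards [h2, shift_coeFn ((a + b) / 2) (t (chi (-((b - a) / 2)) ((b - a) / 2)))]
      with ε h3 h4 h5
    rw [h4]
    refine h3 fun h6 => h5 ⟨?_, ?_⟩
    · linarith [h6.1]
    · linarith [h6.2]

lemma CommutesWithEnergy.inner_chi_of_disjoint (ht : CommutesWithEnergy t)
    (hΓ : ∀ δ, t * shift δ = shift δ * t) {a b c d : ℝ}
    (h : Disjoint (Set.Ioc a b) (Set.Ioc c d)) : inner ℂ (chi a b) (t (chi c d)) = 0 := by
  rw [inner_chi]
  refine setIntegral_eq_zero_of_ae_eq_zero ?_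
  filter_upwards [ht.ae_eq_zero hΓ c d] with ε h1 h2
  exact h1 (Set.disjoint_left.mp h h2)

/-- Cutting (a, b] at x and x + h, locality removes the outer pieces, and the shift by x moves the
middle one to (0, h]. The averages of tχ inside the interval depend on neither the interval nor the
point. -/
lemma CommutesWithEnergy.inner_chi_of_subset (ht : CommutesWithEnergy t)
    (hΓ : ∀ δ, t * shift δ = shift δ * t) {a b x h : ℝ} (hax : a ≤ x) (hh : 0 ≤ h)
    (hxb : x + h ≤ b) :
    inner ℂ (chi x (x + h)) (t (chi a b)) = inner ℂ (chi 0 h) (t (chi 0 h)) := by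
  have hx : x ≤ x + h := le_add_of_nonneg_right hh
  rw [← chi_add hax (hx.trans hxb), ← chi_add hx hxb, map_add, map_add, inner_add_right,
    inner_add_right,
    ht.inner_chi_of_disjoint hΓ (Set.Ioc_disjoint_Ioc_of_le le_rfl).symm,
    ht.inner_chi_of_disjoint hΓ (Set.Ioc_disjoint_Ioc_of_le le_rfl), zero_add, add_zero]
  have h1 : chi x (x + h) = shift x (chi 0 h) := by
    rw [shift_chi, zero_add, add_comm]
  rw [h1, apply_shift hΓ]
  exact (ContinuousLinearMap.inner_map_map_iff_adjoint_comp_self _).mpr (star_shift_mul_self x) _ _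

/-- The operators which commute with the energy and with the shifts are scalars. -/
lemma CommutesWithEnergy.exists_eq_smul_one (ht : CommutesWithEnergy t)
    (hΓ : ∀ δ, t * shift δ = shift δ * t) : ∃ c : ℂ, t = c • 1 := by
  -- The candidate scalar is the density of tχ at a point. Existence of the limit need not be shown
  -- beforehand: Lebesgue differentiation gives it at almost every point of any interval where the
  -- value matters.
  set c : ℂ := Filter.limUnder (nhdsWithin (0 : ℝ) (Set.Ioi 0))
    fun h : ℝ => h⁻¹ • inner ℂ (chi 0 h) (t (chi 0 h)) with hc
  have key : ∀ a b, t (chi a b) = c • chi a b := by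
    intro a b
    apply Lp.ext
    filter_upwards [ae_tendsto_inner_chi (t (chi a b)), ht.ae_eq_zero hΓ a b, chi_coeFn a b,
      Lp.coeFn_smul c (chi a b), compl_mem_ae_iff.mpr (measure_singleton b)] with x h1 h2 h3 h4 h5
    rw [h4, Pi.smul_apply, h3]
    by_cases hx : x ∈ Set.Ioc a b
    · rw [Set.indicator_of_mem hx, smul_eq_mul, mul_one, hc]
      refine (Filter.Tendsto.limUnder_eq (h1.congr' ?_)).symm
      have hxb : 0 < b - x := sub_pos.mpr (lt_of_le_of_ne hx.2 h5)
      filter_upwards [self_mem_nhdsWithin, Ioo_mem_nhdsGT hxb] with h hh hh'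
      rw [ht.inner_chi_of_subset hΓ hx.1.le (le_of_lt hh) (by linarith [hh'.2])]
    · rw [Set.indicator_of_notMem hx, h2 hx, smul_zero]
  refine ⟨c, ?_⟩
  rw [← sub_eq_zero]
  -- As t - c annihilates every indicator, the range of its adjoint is orthogonal to all indicators,
  -- hence zero.
  have h1 : ContinuousLinearMap.adjoint (t - c • 1) = 0 := by
    ext1 ψ
    refine eq_zero_of_inner_chi fun a b => ?_
    rw [ContinuousLinearMap.adjoint_inner_right, sub_apply, key]
    simp
  rw [← ContinuousLinearMap.adjoint_adjoint (t - c • 1), h1, map_zero]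

end Commutant

/-! ### Intertwining the Hamiltonians and classifying admissible unitaries -/

section Intertwining

variable {ι κ : Type*} [Fintype ι] [DecidableEq ι] [Fintype κ] [DecidableEq κ]

/-- The operator `A` intertwines the Hamiltonians `h ⊗ 1 + 1 ⊗ H_W` and `h' ⊗ 1 + 1 ⊗ H_W`. -/
def Intertwines (h h' : Matrix ι ι ℂ) (A : WithWeight ι →L[ℂ] WithWeight ι) : Prop :=
  ∀ Ψ : (totalHamiltonian h).domain, ∃ hA : A Ψ ∈ (totalHamiltonian h').domain,
    totalHamiltonian h' ⟨A Ψ, hA⟩ = A (totalHamiltonian h Ψ)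

lemma Intertwines.mul {h h' h'' : Matrix ι ι ℂ} {A B : WithWeight ι →L[ℂ] WithWeight ι}
    (hB : Intertwines h' h'' B) (hA : Intertwines h h' A) : Intertwines h h'' (B * A) := by
  intro Ψ
  obtain ⟨h1, h2⟩ := hA Ψ
  obtain ⟨h3, h4⟩ := hB ⟨A Ψ, h1⟩
  exact ⟨h3, h4.trans (congrArg B h2)⟩

lemma Intertwines.add {h h' : Matrix ι ι ℂ} {A B : WithWeight ι →L[ℂ] WithWeight ι}
    (hA : Intertwines h h' A) (hB : Intertwines h h' B) : Intertwines h h' (A + B) := by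
  intro Ψ
  obtain ⟨h1, h2⟩ := hA Ψ
  obtain ⟨h3, h4⟩ := hB Ψ
  refine ⟨(totalHamiltonian h').domain.add_mem h1 h3,
    ((totalHamiltonian h').map_add ⟨A Ψ, h1⟩ ⟨B Ψ, h3⟩).trans ?_⟩
  rw [h2, h4]
  rfl

lemma intertwines_zero (h h' : Matrix ι ι ℂ) : Intertwines h h' 0 := fun _ =>
  ⟨(totalHamiltonian h').domain.zero_mem, (totalHamiltonian h').map_zero⟩

lemma Intertwines.sum {h h' : Matrix ι ι ℂ} {A : κ → WithWeight ι →L[ℂ] WithWeight ι}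
    (s : Finset κ) (hA : ∀ k, Intertwines h h' (A k)) : Intertwines h h' (∑ k ∈ s, A k) := by
  induction s using Finset.induction_on with
  | empty => exact intertwines_zero h h'
  | insert k s hk ih => rw [Finset.sum_insert hk]; exact (hA k).add ih

lemma totalHamiltonian_apply (h : Matrix ι ι ℂ) (Ψ : (totalHamiltonian h).domain) (a : ι) :
    totalHamiltonian h Ψ a =
      (∑ b, h a b • (Ψ : WithWeight ι) b) + weightHamiltonian ⟨(Ψ : WithWeight ι) a, Ψ.2 a⟩ := rfl

/-- Writing ε = (ε - δ) + δ yields at once the invariance of the domain and the commutation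
relation. -/
lemma mul_shift_ae (δ : ℝ) (ψ : weightHamiltonian.domain) :
    (fun ε : ℝ => (ε : ℂ) * shift δ ψ ε) =ᵐ[volume]
      (shift δ (weightHamiltonian ψ) + (δ : ℂ) • shift δ ψ : Weight) := by
  have h := (measurePreserving_sub_right volume δ).quasiMeasurePreserving.ae
    (weightHamiltonian_coeFn ψ)
  filter_upwards [Lp.coeFn_add (shift δ (weightHamiltonian ψ)) ((δ : ℂ) • shift δ (ψ : Weight)),
    Lp.coeFn_smul (δ : ℂ) (shift δ (ψ : Weight)), shift_coeFn δ (weightHamiltonian ψ),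
    shift_coeFn δ (ψ : Weight), h] with ε h1 h2 h3 h4 h5
  rw [h1, Pi.add_apply, h2, Pi.smul_apply, h3, h4, h5, smul_eq_mul]
  push_cast
  ring

lemma shift_mem_domain (δ : ℝ) (ψ : weightHamiltonian.domain) :
    shift δ ψ ∈ weightHamiltonian.domain :=
  (memLp_congr_ae (mul_shift_ae δ ψ)).mpr (Lp.memLp _)

/-- The commutation relation of the energy and the shifts. -/
lemma weightHamiltonian_shift (δ : ℝ) (ψ : weightHamiltonian.domain) :
    weightHamiltonian ⟨shift δ ψ, shift_mem_domain δ ψ⟩ =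
      shift δ (weightHamiltonian ψ) + (δ : ℂ) • shift δ ψ :=
  Lp.ext ((weightHamiltonian_coeFn _).trans (mul_shift_ae δ ψ))

lemma tensor_apply (A : Matrix ι ι ℂ) (T : Weight →L[ℂ] Weight) (Ψ : WithWeight ι) (a : ι) :
    tensor A T Ψ a = ∑ b, A a b • T (Ψ b) := by
  rw [apply_eq_sum_block]
  simp [block_tensor]

/-- Moving H_W through Γ_δ produces δA ⊗ Γ_δ; the hypothesis says that this term accounts for the
difference between h'A and Ah. -/
lemma intertwines_tensor_shift {h h' A : Matrix ι ι ℂ} {δ : ℝ}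
    (hA : h' * A + (δ : ℂ) • A = A * h) : Intertwines h h' (tensor A (shift δ)) := by
  intro Ψ
  set φ : ι → weightHamiltonian.domain := fun b => ⟨(Ψ : WithWeight ι) b, Ψ.2 b⟩
  have hcomp : ∀ a, tensor A (shift δ) Ψ a =
      ((∑ b, A a b • (⟨shift δ (φ b), shift_mem_domain δ (φ b)⟩ : weightHamiltonian.domain) :
        weightHamiltonian.domain) : Weight) := by
    intro a
    rw [tensor_apply]
    simp [φ]
  have hdom : tensor A (shift δ) Ψ ∈ (totalHamiltonian h').domain := by
    intro a
    rw [hcomp a]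
    exact Subtype.property _
  refine ⟨hdom, ?_⟩
  ext1 a
  rw [totalHamiltonian_apply, tensor_apply A (shift δ) (totalHamiltonian h Ψ) a]
  have h1 : weightHamiltonian ⟨tensor A (shift δ) Ψ a, hdom a⟩ =
      ∑ b, A a b • (shift δ (weightHamiltonian (φ b)) + (δ : ℂ) • shift δ (φ b)) := by
    have h2 : (⟨tensor A (shift δ) Ψ a, hdom a⟩ : weightHamiltonian.domain) =
        ∑ b, A a b • (⟨shift δ (φ b), shift_mem_domain δ (φ b)⟩ : weightHamiltonian.domain) :=
      Subtype.ext (hcomp a)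
    rw [h2]
    change weightHamiltonian.toFun _ = _
    rw [map_sum]
    refine Finset.sum_congr rfl fun b _ => ?_
    rw [map_smul]
    exact congrArg (A a b • ·) (weightHamiltonian_shift δ (φ b))
  have h3 : ∀ b, (A * h) a b = (h' * A) a b + δ * A a b := fun b => by
    rw [← hA]
    rfl
  change _ + weightHamiltonian ⟨tensor A (shift δ) Ψ a, hdom a⟩ = _
  rw [h1]
  have h4 : ∀ b, shift δ (totalHamiltonian h Ψ b) =
      (∑ c, h b c • shift δ (φ c)) + shift δ (weightHamiltonian (φ b)) := fun b => by
    rw [totalHamiltonian_apply, map_add, map_sum]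
    simp only [map_smul]
    rfl
  have h5 : ∑ b, h' a b • tensor A (shift δ) Ψ b = ∑ c, (h' * A) a c • shift δ (φ c) := by
    simp only [tensor_apply, Finset.smul_sum, smul_smul, Matrix.mul_apply, Finset.sum_smul]
    exact Finset.sum_comm
  have h6 : ∑ b, A a b • ∑ c, h b c • shift δ (φ c) = ∑ c, (A * h) a c • shift δ (φ c) := by
    simp only [Finset.smul_sum, smul_smul, Matrix.mul_apply, Finset.sum_smul]
    exact Finset.sum_comm
  simp only [h4, smul_add, Finset.sum_add_distrib]
  rw [h5, h6]
  simp only [h3, add_smul, Finset.sum_add_distrib, smul_smul]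
  simp only [mul_comm (δ : ℂ)]
  abel

lemma intertwines_tensor_one (V : Matrix ι ι ℂ) : Intertwines 0 0 (tensor V 1) := by
  rw [← shift_zero]
  exact intertwines_tensor_shift (by simp)

variable {P : κ → Matrix ι ι ℂ}

lemma IsResolution.sum_smul_mul (hP : IsResolution P) (E : κ → ℂ) (k : κ) :
    (∑ l, E l • P l) * P k = E k • P k := by
  rw [Finset.sum_mul, Finset.sum_eq_single k]
  · rw [Matrix.smul_mul, hP.mul_eq, if_pos rfl]
  · intro l _ hl
    rw [Matrix.smul_mul, hP.mul_eq, if_neg hl, smul_zero]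
  · simp

lemma IsResolution.mul_sum_smul (hP : IsResolution P) (E : κ → ℂ) (k : κ) :
    P k * (∑ l, E l • P l) = E k • P k := by
  rw [Finset.mul_sum, Finset.sum_eq_single k]
  · rw [Matrix.mul_smul, hP.mul_eq, if_pos rfl]
  · intro l _ hl
    rw [Matrix.mul_smul, hP.mul_eq, if_neg hl.symm, smul_zero]
  · simp

/-- On the k-th level the energy E_k gained from the shift matches the one lost by the system, so
all of the system's Hamiltonian is absorbed into H_W. -/
lemma intertwines_ctrl (hP : IsResolution P) (E : κ → ℝ) :
    Intertwines (∑ k, (E k : ℂ) • P k) 0 (ctrl P E) :=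
  Intertwines.sum _ fun k => intertwines_tensor_shift (by
    rw [zero_mul, zero_add, hP.mul_sum_smul])

lemma intertwines_star_ctrl (hP : IsResolution P) (E : κ → ℝ) :
    Intertwines 0 (∑ k, (E k : ℂ) • P k) (star (ctrl P E)) := by
  rw [star_ctrl hP]
  exact Intertwines.sum _ fun k => intertwines_tensor_shift (by
    rw [mul_zero, hP.sum_smul_mul]
    simp)

lemma Intertwines.commutesWithEnergy_block {T : WithWeight ι →L[ℂ] WithWeight ι}
    (hT : Intertwines 0 0 T) (a b : ι) : CommutesWithEnergy (block T a b) := by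
  intro ψ
  have hdom : inj b (ψ : Weight) ∈ (totalHamiltonian (0 : Matrix ι ι ℂ)).domain := by
    intro c
    rw [inj_apply]
    split_ifs
    · exact ψ.2
    · exact weightHamiltonian.domain.zero_mem
  obtain ⟨h1, h2⟩ := hT ⟨inj b ψ, hdom⟩
  refine ⟨h1 a, ?_⟩
  have h3 : totalHamiltonian (0 : Matrix ι ι ℂ) ⟨inj b ψ, hdom⟩ = inj b (weightHamiltonian ψ) := by
    ext1 c
    rw [totalHamiltonian_apply]
    simp only [Matrix.zero_apply, zero_smul, Finset.sum_const_zero, zero_add]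
    rw [inj_apply b (weightHamiltonian ψ) c]
    split_ifs with hc
    · congr 1
      exact Subtype.ext ((inj_apply b (ψ : Weight) c).trans (if_pos hc))
    · rw [← weightHamiltonian.map_zero]
      congr 1
      exact Subtype.ext ((inj_apply b (ψ : Weight) c).trans (if_neg hc))
  have h4 := congrArg (fun Φ : WithWeight ι => Φ a) h2
  simp only [totalHamiltonian_apply, Matrix.zero_apply, zero_smul, Finset.sum_const_zero,
    zero_add] at h4
  rw [h3] at h4
  exact h4

lemma block_commute_shift {T : WithWeight ι →L[ℂ] WithWeight ι}
    (hT : ∀ δ, T * tensor 1 (shift δ) = tensor 1 (shift δ) * T) (a b : ι) (δ : ℝ) :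
    block T a b * shift δ = shift δ * block T a b := by
  have h := congrArg (fun S => block S a b) (hT δ)
  simpa [block_mul, block_tensor, Matrix.one_apply] using h

/-- The operators which commute with the energy and with the shifts of the weight act on the
system only. -/
lemma exists_eq_tensor_one {T : WithWeight ι →L[ℂ] WithWeight ι} (hT : Intertwines 0 0 T)
    (hΓ : ∀ δ, T * tensor 1 (shift δ) = tensor 1 (shift δ) * T) :
    ∃ V : Matrix ι ι ℂ, T = tensor V 1 := by
  choose V hV using fun a b =>
    (hT.commutesWithEnergy_block a b).exists_eq_smul_one (block_commute_shift hΓ a b)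
  refine ⟨Matrix.of V, ext_block fun a b => ?_⟩
  rw [hV, block_tensor, Matrix.of_apply]

lemma tensor_one_injective {V W : Matrix ι ι ℂ} (h : tensor V 1 = tensor W 1) : V = W := by
  ext a b
  have h1 := congrArg (fun S => block S a b (chi 0 1)) h
  simp only [block_tensor, smul_apply, one_apply_eq_self] at h1
  -- The test vector is nonzero: the indicator of (0, 1] has squared norm 1.
  refine smul_left_injective ℂ (fun h0 => ?_) h1
  have h2 := inner_chi 0 1 (chi 0 1)
  rw [setIntegral_congr_ae measurableSet_Ioc ((chi_coeFn 0 1).mono fun ε hε _ => hε),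
    setIntegral_indicator measurableSet_Ioc, h0, inner_zero_left] at h2
  simp at h2

lemma mem_unitaryGroup_of_tensor {V : Matrix ι ι ℂ} (h : tensor V 1 * star (tensor V 1) = 1) :
    V ∈ Matrix.unitaryGroup ι ℂ := by
  rw [Matrix.mem_unitaryGroup_iff]
  apply tensor_one_injective
  rw [tensor_one_one, ← h, star_tensor, tensor_mul, star_one, one_mul, Matrix.star_eq_conjTranspose]

/-- Admissible unitaries are the conjugates of the unitaries of the system. -/
lemma isAdmissible_iff (hP : IsResolution P) (E : κ → ℝ) (U : WithWeight ι →L[ℂ] WithWeight ι) :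
    IsAdmissible (∑ k, (E k : ℂ) • P k) U ↔
      ∃ V ∈ Matrix.unitaryGroup ι ℂ, U = star (ctrl P E) * tensor V 1 * ctrl P E := by
  have h1 := star_ctrl_mul_self hP E
  have h2 := ctrl_mul_star_self hP E
  have hstar : ∀ δ, star (ctrl P E) * tensor 1 (shift δ) = tensor 1 (shift δ) * star (ctrl P E) :=
    fun δ => by rw [star_ctrl hP, ctrl_mul_shift]
  constructor
  · intro hU
    have hcomm : ∀ δ, ctrl P E * U * star (ctrl P E) * tensor 1 (shift δ) =
        tensor 1 (shift δ) * (ctrl P E * U * star (ctrl P E)) := fun δ => by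
      rw [mul_assoc _ (star _), hstar, ← mul_assoc, mul_assoc _ U, hU.translation_invariant,
        ← mul_assoc, ctrl_mul_shift]
      simp only [mul_assoc]
    -- Energy conservation is the statement that U intertwines the total Hamiltonian with itself, so
    -- it composes with the two control shifts.
    have hint : Intertwines 0 0 (ctrl P E * U * star (ctrl P E)) :=
      ((intertwines_ctrl hP E).mul hU.energy_conserving).mul (intertwines_star_ctrl hP E)
    obtain ⟨V, hV⟩ := exists_eq_tensor_one hint hcomm
    refine ⟨V, mem_unitaryGroup_of_tensor ?_, ?_⟩
    · rw [← hV]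
      simp only [star_mul, star_star]
      calc ctrl P E * U * star (ctrl P E) * (ctrl P E * (star U * star (ctrl P E)))
          = ctrl P E * U * (star (ctrl P E) * ctrl P E) * star U * star (ctrl P E) := by
            simp only [mul_assoc]
        _ = 1 := by
            rw [h1, mul_one, mul_assoc _ U, (Unitary.mem_iff.mp hU.unitary).2, mul_one, h2]
    · rw [← hV]
      calc U = (star (ctrl P E) * ctrl P E) * U * (star (ctrl P E) * ctrl P E) := by
            rw [h1, one_mul, mul_one]
        _ = _ := by simp only [mul_assoc]
  · rintro ⟨V, hV, rfl⟩
    have h3 := star_tensor_mul_self hV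
    have h4 : tensor V 1 * star (tensor V 1) = 1 := by
      rw [star_tensor, tensor_mul, star_one, one_mul, unitary_mul_conjTranspose hV, tensor_one_one]
    refine ⟨?_, ?_, ?_⟩
    · rw [Unitary.mem_iff]
      simp only [star_mul, star_star]
      constructor
      · calc star (ctrl P E) * (star (tensor V 1) * ctrl P E) *
            (star (ctrl P E) * tensor V 1 * ctrl P E)
            = star (ctrl P E) * (star (tensor V 1) * (ctrl P E * star (ctrl P E)) * tensor V 1) *
              ctrl P E := by simp only [mul_assoc]
          _ = 1 := by rw [h2, mul_one, h3, mul_one, h1]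
      · calc star (ctrl P E) * tensor V 1 * ctrl P E *
            (star (ctrl P E) * (star (tensor V 1) * ctrl P E))
            = star (ctrl P E) * (tensor V 1 * (ctrl P E * star (ctrl P E)) * star (tensor V 1)) *
              ctrl P E := by simp only [mul_assoc]
          _ = 1 := by rw [h2, mul_one, h4, mul_one, h1]
    · exact ((intertwines_star_ctrl hP E).mul (intertwines_tensor_one V)).mul
        (intertwines_ctrl hP E)
    · intro δ
      rw [mul_assoc, ctrl_mul_shift, ← mul_assoc, mul_assoc _ (tensor V 1), tensor_mul, mul_one,
        one_mul]
      have h5 : tensor V (shift δ) = tensor 1 (shift δ) * tensor V 1 := by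
        rw [tensor_mul, one_mul, mul_one]
      rw [h5, ← mul_assoc, hstar]
      simp only [mul_assoc]

end Intertwining

end Ergo

end

/-! ### The theorem -/

theorem theorem1 {n m : Type*} [Fintype n] [DecidableEq n] [Fintype m] [DecidableEq m] [Nonempty m]
    (H_S : Matrix n n ℂ) (hS : H_S.IsHermitian) (H_B : Matrix m m ℂ) (hB : H_B.IsHermitian)
    (β : ℝ) :
    -- the admissible unitaries are exactly the operators `S† (V_SB ⊗ 1) S`, with `V_SB` unitary
    (∀ U : Ergo.WithWeight (n × m) →L[ℂ] Ergo.WithWeight (n × m),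
      Ergo.IsAdmissible (Ergo.hamiltonianSB H_S H_B) U ↔
        ∃ V ∈ Matrix.unitaryGroup (n × m) ℂ, U = Ergo.dressed hS hB V) ∧
    -- initial states `ρ_SW ⊗ τ_B`
    (∀ ρ : Ergo.WithWeight n →L[ℂ] Ergo.WithWeight n, Ergo.IsDensityOperator ρ →
      Ergo.IsDensityOperator (Ergo.attachBath ρ (Ergo.gibbs β H_B)) ∧
      Ergo.traceOutWeight (Ergo.controlShiftSB hS hB * Ergo.attachBath ρ (Ergo.gibbs β H_B) *
          star (Ergo.controlShiftSB hS hB)) =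
        Ergo.controlMarginal hS ρ ⊗ₖ Ergo.gibbs β H_B ∧
      Ergo.IsDensityMatrix (Ergo.controlMarginal hS ρ) ∧
      (∃ V ∈ Matrix.unitaryGroup (n × m) ℂ,
        Ergo.ergotropy (Ergo.hamiltonianSB H_S H_B)
          (V * (Ergo.controlMarginal hS ρ ⊗ₖ Ergo.gibbs β H_B) * Vᴴ) = 0) ∧
      (Ergo.HasFiniteEnergy (Ergo.weightMarginal ρ) →
        Ergo.HasFiniteEnergy (Ergo.weightMarginal (Ergo.attachBath ρ (Ergo.gibbs β H_B))) ∧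
        (∀ V ∈ Matrix.unitaryGroup (n × m) ℂ,
          Ergo.HasFiniteEnergy
            (Ergo.finalWeight (Ergo.dressed hS hB V) (Ergo.attachBath ρ (Ergo.gibbs β H_B))) ∧
          Ergo.work (Ergo.dressed hS hB V) (Ergo.attachBath ρ (Ergo.gibbs β H_B)) =
            Ergo.ergotropy (Ergo.hamiltonianSB H_S H_B)
                (Ergo.controlMarginal hS ρ ⊗ₖ Ergo.gibbs β H_B) -
              Ergo.ergotropy (Ergo.hamiltonianSB H_S H_B)
                (V * (Ergo.controlMarginal hS ρ ⊗ₖ Ergo.gibbs β H_B) * Vᴴ)) ∧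
        IsGreatest
          {W : ℝ | ∃ U, Ergo.IsAdmissible (Ergo.hamiltonianSB H_S H_B) U ∧
            W = Ergo.work U (Ergo.attachBath ρ (Ergo.gibbs β H_B))}
          (Ergo.ergotropy (Ergo.hamiltonianSB H_S H_B)
            (Ergo.controlMarginal hS ρ ⊗ₖ Ergo.gibbs β H_B)))) ∧
    -- product states `ρ_SW = ρ_S ⊗ ρ_W`
    (∀ (ρ_S : Matrix n n ℂ) (ρ_W : Ergo.Weight →L[ℂ] Ergo.Weight),
      Ergo.IsDensityMatrix ρ_S → Ergo.IsDensityOperator ρ_W →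
      Ergo.IsDensityOperator (Ergo.tensor ρ_S ρ_W) ∧
      Ergo.weightMarginal (Ergo.tensor ρ_S ρ_W) = ρ_W ∧
      Integrable (fun t => (Ergo.timeDensity ρ_W t).toReal) ∧
      ∫ t, (Ergo.timeDensity ρ_W t).toReal = 1 ∧
      Ergo.controlMarginal hS (Ergo.tensor ρ_S ρ_W) =
        Matrix.of fun a b => ∫ t, ((Ergo.timeDensity ρ_W t).toReal : ℂ) *
          (Ergo.evolution H_S t * ρ_S * (Ergo.evolution H_S t)ᴴ) a b) := by
  have hadm : ∀ U : Ergo.WithWeight (n × m) →L[ℂ] Ergo.WithWeight (n × m),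
      Ergo.IsAdmissible (Ergo.hamiltonianSB H_S H_B) U ↔
        ∃ V ∈ Matrix.unitaryGroup (n × m) ℂ, U = Ergo.dressed hS hB V := by
    intro U
    have h := Ergo.isAdmissible_iff (Ergo.isResolution_eigenProjSB hS hB)
      (fun p => hS.eigenvalues p.1 + hB.eigenvalues p.2) U
    rwa [Ergo.sum_eigenvalues_smul_eigenProjSB, ← Ergo.controlShiftSB_eq_ctrl] at h
  refine ⟨hadm, fun ρ hρ => ?_, fun ρ_S ρ_W hρ_S hρ_W => ?_⟩
  · have hρτ := Ergo.isDensityOperator_attachBath hρ (Ergo.isDensityMatrix_gibbs hB β)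
    have htr := Ergo.traceOutWeight_conj_controlShiftSB hS hB hρ β
    refine ⟨hρτ, htr, Ergo.isDensityMatrix_controlMarginal hS hρ,
      Ergo.exists_ergotropy_conj_eq_zero _ _, fun hE => ?_⟩
    rw [← Ergo.weightMarginal_attachBath ρ (Ergo.isDensityMatrix_gibbs hB β).trace_one] at hE
    have hwork : ∀ V ∈ Matrix.unitaryGroup (n × m) ℂ, _ := fun V hV =>
      htr ▸ Ergo.work_dressed hS hB hρτ hV hE
    refine ⟨hE, hwork, ?_, ?_⟩
    -- The bound is attained by a unitary taking σ_S ⊗ τ_B to a state without ergotropy.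
    · obtain ⟨V, hV, h0⟩ := Ergo.exists_ergotropy_conj_eq_zero (Ergo.hamiltonianSB H_S H_B)
        (Ergo.controlMarginal hS ρ ⊗ₖ Ergo.gibbs β H_B)
      exact ⟨Ergo.dressed hS hB V, (hadm _).mpr ⟨V, hV, rfl⟩, by rw [(hwork V hV).2, h0, sub_zero]⟩
    · rintro W ⟨U, hU, rfl⟩
      obtain ⟨V, hV, rfl⟩ := (hadm U).mp hU
      rw [(hwork V hV).2]
      exact sub_le_self _ (Ergo.ergotropy_nonneg _ _)
  · exact ⟨Ergo.isDensityOperator_tensor hρ_S hρ_W, Ergo.weightMarginal_tensor hρ_S.trace_one ρ_W,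
      Ergo.integrable_timeDensity hρ_W, Ergo.integral_timeDensity hρ_W,
      Ergo.controlMarginal_tensor hS ρ_S hρ_W⟩
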